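/- Let $\mathcal L_\beta$ and $\mathcal L_\alpha$ be first-order languages such that every function symbol (including constants) of $\mathcal L_\alpha$ lies in $\mathcal L_\beta$; put $\mathcal L=\mathcal L_\alpha\cap\mathcal L_\beta$ and $\mathcal L^2=\mathcal L_\beta\cup\mathcal L_\alpha\cup\{A\}$ with $A$ a new unary predicate symbol. Let $T_\alpha$ be an $\mathcal L_\alpha$-theory and let $T_\beta$ be a geometric $\mathcal L_\beta$-theory, i.e. $T_\beta$ eliminates $\exists^\infty$ and algebraic closure $\operatorname{acl}$ defines a pregeometry in every model of $T_\beta$. For an $\mathcal L_\alpha$-formula $\theta$ let $\theta_A$ be the $\mathcal L^2$-formula obtained by restricting all quantifiers of $\theta$ to $A$. Let $T^2$ be the $\mathcal L^2$-theory consisting of $T_\beta$, all $\phi_A$ for $\mathcal L_\alpha$-sentences $\phi$ with $T_\alpha\models\phi$, sentences saying that $A$ is closed under the function symbols of $\mathcal L_\alpha$, and sentences saying that each relation symbol in $\mathcal L_\alpha\setminus\mathcal L_\beta$ holds only of tuples from $A$. A model of $T^2$ is written $(\mathcal B,\mathcal A)$, where $\mathcal B$ (with underlying set $B$) is its $\mathcal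 L_\beta$-reduct and $\mathcal A$ is the $\mathcal L_\alpha$-structure induced on the set $A$ defined by the predicate $A$; $\operatorname{acl}$ is computed in $\mathcal B$. For subsets of $B$, $X$ and $Y$ are independent over $Z$ if every subset of $X$ that is $\operatorname{acl}$-independent over $Z$ is $\operatorname{acl}$-independent over $Y\cup Z$. Types are complete and realizable. Let $T\supseteq T^2$ be an $\mathcal L^2$-theory. A Mordell-Lang challenge is a tuple $(p(\vec x_\alpha),q(\vec x),\phi(\vec x,y),\psi(\vec x_\alpha,y))$, where $\vec x_\alpha$ is a subtuple of the finite tuple of variables $\vec x$, $p$ is a complete $\mathcal L_\alpha$-type, $q$ is a complete $\mathcal L_\beta$-type, $\phi$ is an $\mathcal L_\beta$-formula, $\psi$ is an $\mathcal L_\alpha$-formula and $q(\vec x)\models\exists^{<\infty}y\,\phi(\vec x,y)$. A contender is a model $(\mathcal B,\mathcal A)\models T$ with a tuple $\vec c$ from $B$ such that $\vec c$ realizes $q$, the subtuple $\vec c_\alpha$ of the components of $\vec c$ that lie in $A$ corresponds to $\vec x_\alpha$ and realizes $p_A=\{\theta_A:\theta\in p\}$, and $\vec c$ and $A$ are independent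 over $\vec c_\alpha$. A solution is a contender with an $a\in A$ such that $(\mathcal B,\mathcal A)\models\phi(\vec c,a)\wedge\psi_A(\vec c_\alpha,a)$. The theory $T$ is an ML-theory if 1. $T\supseteq T^2$; 2. for every Mordell-Lang challenge that has some solution, every contender $((\mathcal B,\mathcal A),\vec c)$ extends to a solution $((\mathcal B,\mathcal A),\vec c,a)$; 3. for every cardinal $\kappa>\max(\aleph_0,|\mathcal L^2|)$, every $\kappa$-saturated $(\mathcal B,\mathcal A)\models T$, every $C\subseteq B$ with $|C|<\kappa$ and every non-algebraic unary $\mathcal L_\beta(C)$-type $q(x)$: (density) if $p(x)$ is a unary $\mathcal L_\alpha(A\cap C)$-type, computed in $\mathcal A$, such that $q$ implies all quantifier-free $\mathcal L(A\cap C)$-formulas in $p$, then some $a\in A$ realizes $p_A\cup q$; and (codensity) some $b\in B\setminus\operatorname{acl}(A\cup C)$ realizes $q$. A special formula (with parameters from a set $C$) is one of the form $$\theta(\vec y)=\exists\vec x\,\bigl(A(\vec x)\wedge\psi_A(\vec x)\wedge\phi(\vec x,\vec y)\bigr),$$ where $\psi(\vec x)$ is an $\mathcal L_\alpha$-formula and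 $\phi(\vec x,\vec y)$ is an $\mathcal L_\beta$-formula (an $\mathcal L_\beta(C)$-formula), and $A(\vec x)$ says that all components of $\vec x$ lie in $A$. **Theorem.** Let $T$ be an ML-theory. (a) Every $\mathcal L^2$-formula is equivalent in $T$ to a boolean combination of special formulas without parameters. (b) For every model $(\mathcal B,\mathcal A)$ of $T$ and every $C\subseteq B$ (in particular for $C=B$), every $\mathcal L^2(C)$-formula is equivalent, in $T$ regarded as an $\mathcal L^2(C)$-theory, to a boolean combination of special formulas with parameters from $C$. (c) If $T_\alpha$ and $T_\beta$ are model complete (every embedding between models is elementary), then $T$ is near model complete, that is, every $\mathcal L^2$-formula is equivalent in $T$ to a boolean combination of existential $\mathcal L^2$-formulas. -/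

import Mathlib

open FirstOrder FirstOrder.Language Cardinal

universe u v w

namespace MLPairs

section General

/-- The model-theoretic algebraic closure of a set `X` in an `L`-structure: the union of all finite
`L(X)`-definable subsets. -/
def acl (L : FirstOrder.Language.{u, v}) {M : Type w} [L.Structure M] (X : Set M) : Set M :=
  {b | ∃ s : Set M, X.Definable₁ L s ∧ s.Finite ∧ b ∈ s}

/-- A closure operator on a set is a pregeometry: it is extensive, monotone, idempotent, of finite
character, and has the exchange property. -/
structure IsPregeometry {M : Type w} (cl : Set M → Set M) : Prop where
  subset_cl : ∀ X, X ⊆ cl X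
  mono : ∀ X Y, X ⊆ Y → cl X ⊆ cl Y
  idem : ∀ X, cl (cl X) = cl X
  finitary : ∀ X, ∀ b ∈ cl X, ∃ Y ⊆ X, Y.Finite ∧ b ∈ cl Y
  exchange : ∀ X a b, a ∈ cl (insert b X) → a ∉ cl X → b ∈ cl (insert a X)

/-- `T` eliminates the quantifier "there are infinitely many": for each formula `φ(x, y)` there is a
formula `χ(x)` that holds at `c` exactly when `φ(c, y)` has infinitely many solutions `y`. -/
def EliminatesInfinity {L : FirstOrder.Language.{u, v}} (T : L.Theory) : Prop :=
  ∀ (n : ℕ) (φ : L.Formula (Fin n ⊕ Unit)), ∃ χ : L.Formula (Fin n),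
    ∀ (M : Theory.ModelType.{u, v, max u v} T) (c : Fin n → M),
      χ.Realize c ↔ {y : M | φ.Realize (Sum.elim c fun _ => y)}.Infinite

/-- `T` is geometric. -/
structure IsGeometric {L : FirstOrder.Language.{u, v}} (T : L.Theory) : Prop where
  eliminatesInfinity : EliminatesInfinity T
  pregeometry : ∀ M : Theory.ModelType.{u, v, max u v} T, IsPregeometry (acl L (M := M))

/-- The set `X` is independent over `Z` with respect to the closure operator `cl`. -/
def ClIndependent {M : Type w} (cl : Set M → Set M) (X Z : Set M) : Prop :=
  ∀ x ∈ X, x ∉ cl (Z ∪ X \ {x})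

/-- `X` and `Y` are independent over `Z`: every subset of `X` that is independent over `Z` is also
independent over `Y ∪ Z`. -/
def IndependentOver {M : Type w} (cl : Set M → Set M) (X Y Z : Set M) : Prop :=
  ∀ X₀ ⊆ X, ClIndependent cl X₀ Z → ClIndependent cl X₀ (Y ∪ Z)

/-- A tuple `c` realizes the complete type `p` (over the empty set). -/
def RealizesType {L : FirstOrder.Language.{u, v}} {T : L.Theory} {γ : Type} {M : Type w} [L.Structure M]
    (p : T.CompleteType γ) (c : γ → M) : Prop :=
  ∀ φ : L.Formula γ, Formula.equivSentence φ ∈ p → φ.Realize c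

/-- `p` is a complete `n`-type over `C` computed in `M`. In the description of types over `C`, an
`L(C)`-formula in the variables `x` is given as an `L`-formula in `x` and in variables indexed by
`C`; the latter are always evaluated at the parameters that they stand for. -/
structure IsTypeOver {L : FirstOrder.Language.{u, v}} {M : Type w} [L.Structure M] {C : Set M} {n : ℕ}
    (p : Set (L.Formula (C ⊕ Fin n))) : Prop where
  finSat : ∀ s ⊆ p, s.Finite → ∃ c : Fin n → M, ∀ φ ∈ s, φ.Realize (Sum.elim (fun e => (e : M)) c)
  complete : ∀ φ : L.Formula (C ⊕ Fin n), φ ∈ p ∨ φ.not ∈ p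

/-- `c` realizes the type `p` over `C`. -/
def RealizesTypeOver {L : FirstOrder.Language.{u, v}} {M : Type w} [L.Structure M] {C : Set M} {n : ℕ}
    (p : Set (L.Formula (C ⊕ Fin n))) (c : Fin n → M) : Prop :=
  ∀ φ ∈ p, φ.Realize (Sum.elim (fun e => (e : M)) c)

/-- A unary type over `C` is non-algebraic: none of its formulas has only finitely many
solutions. -/
def NonAlgebraic {L : FirstOrder.Language.{u, v}} {M : Type w} [L.Structure M] {C : Set M}
    (q : Set (L.Formula (C ⊕ Fin 1))) : Prop :=
  ∀ φ ∈ q, {b : M | φ.Realize (Sum.elim (fun e => (e : M)) fun _ => b)}.Infinite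

/-- `M` is `κ`-saturated. -/
def IsSaturated (L : FirstOrder.Language.{u, v}) (κ : Cardinal.{w}) (M : Type w) [L.Structure M] : Prop :=
  ∀ C : Set M, #C < κ → ∀ (n : ℕ) (p : Set (L.Formula (C ⊕ Fin n))), IsTypeOver p →
    ∃ c : Fin n → M, RealizesTypeOver p c

/-- The boolean combinations of the formulas that satisfy `P`. -/
inductive IsBoolComb {L : FirstOrder.Language.{u, v}} {γ : Type w} (P : L.Formula γ → Prop) :
    L.Formula γ → Prop
  | basic {φ : L.Formula γ} : P φ → IsBoolComb P φ
  | bot : IsBoolComb P ⊥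
  | not {φ : L.Formula γ} : IsBoolComb P φ → IsBoolComb P φ.not
  | inf {φ ψ : L.Formula γ} : IsBoolComb P φ → IsBoolComb P ψ → IsBoolComb P (φ ⊓ ψ)
  | sup {φ ψ : L.Formula γ} : IsBoolComb P φ → IsBoolComb P ψ → IsBoolComb P (φ ⊔ ψ)

/-- `T` is model complete: every embedding between models of `T` is elementary. -/
def ModelComplete {L : FirstOrder.Language.{u, v}} (T : L.Theory) : Prop :=
  ∀ (M N : Theory.ModelType.{u, v, max u v} T) (f : M ↪[L] N) (n : ℕ) (φ : L.Formula (Fin n))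
    (c : Fin n → M), φ.Realize (f ∘ c) ↔ φ.Realize c

/-- `T` is near model complete: every formula is equivalent in `T` to a boolean combination of
existential formulas. -/
def NearModelComplete {L : FirstOrder.Language.{u, v}} (T : L.Theory) : Prop :=
  ∀ (n : ℕ) (φ : L.Formula (Fin n)), ∃ χ : L.Formula (Fin n),
    IsBoolComb (fun θ : L.Formula (Fin n) => BoundedFormula.IsExistential θ) χ ∧ φ ⇔[T] χ

end General

/-- The symbols of two overlapping languages `L_β` and `L_α` such that all function symbols of
`L_α` are in `L_β`, sorted into three disjoint families: the symbols of the intersection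
`L = L_α ∩ L_β`, those of `L_β \ L`, and those of `L_α \ L`, which are all relation symbols.
Constant symbols are nullary function symbols. -/
structure PairLanguage where
  common : FirstOrder.Language.{u, v}
  betaOnly : FirstOrder.Language.{u, v}
  alphaOnly : ℕ → Type v

/-- The relation symbols of `L²` that are not in `L_β`: those of `L_α \ L_β`, and the new unary
predicate symbol `A`. -/
inductive ExtraRel (R : ℕ → Type v) : ℕ → Type v
  | ofAlpha {n : ℕ} : R n → ExtraRel R n
  | predA : ExtraRel R 1

namespace PairLanguage

variable (S : PairLanguage.{u, v})

/-- The language `L_β`. -/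
def Lβ : FirstOrder.Language.{u, v} := S.common.sum S.betaOnly

/-- The language `L_α`. -/
def Lα : FirstOrder.Language.{u, v} := S.common.sum ⟨fun _ => PEmpty.{u + 1}, S.alphaOnly⟩

/-- The language `L² = L_β ∪ L_α ∪ {A}`. -/
def L2 : FirstOrder.Language.{u, v} := S.Lβ.sum ⟨fun _ => PEmpty.{u + 1}, ExtraRel S.alphaOnly⟩

/-- The inclusion of `L` in `L_β`. -/
def commonToβ : S.common →ᴸ S.Lβ := LHom.sumInl

/-- The inclusion of `L` in `L_α`. -/
def commonToα : S.common →ᴸ S.Lα := LHom.sumInl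

/-- The inclusion of `L_β` in `L²`. -/
def βTo2 : S.Lβ →ᴸ S.L2 := LHom.sumInl

/-- The inclusion of `L_α` in `L²`. -/
def αTo2 : S.Lα →ᴸ S.L2 :=
  LHom.sumElim (S.βTo2.comp S.commonToβ)
    { onFunction := fun _ f => f.elim
      onRelation := fun _ r => Sum.inr (ExtraRel.ofAlpha r) }

/-- The unary predicate symbol `A` of `L²`. -/
def predA : S.L2.Relations 1 := Sum.inr ExtraRel.predA

/-- The `L_β`-reduct of an `L²`-structure. -/
instance instStructureβ (M : Type w) [S.L2.Structure M] : S.Lβ.Structure M := S.βTo2.reduct M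

/-- The `L_α`-reduct of an `L²`-structure. -/
instance instStructureα (M : Type w) [S.L2.Structure M] : S.Lα.Structure M := S.αTo2.reduct M

/-- The underlying set of the predicate `A` in an `L²`-structure. -/
def setA (M : Type w) [S.L2.Structure M] : Set M := {x | Structure.RelMap S.predA ![x]}

/-- The relativization `θ_A` of an `L_α`-formula `θ` to the predicate `A` on bounded formulas: all
quantifiers are restricted to `A`. -/
def relativizeBdd {γ : Type w} : ∀ {n : ℕ}, S.Lα.BoundedFormula γ n → S.L2.BoundedFormula γ n
  | _, BoundedFormula.falsum => BoundedFormula.falsum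
  | _, BoundedFormula.equal t₁ t₂ =>
      BoundedFormula.equal (S.αTo2.onTerm t₁) (S.αTo2.onTerm t₂)
  | _, BoundedFormula.rel R ts =>
      BoundedFormula.rel (S.αTo2.onRelation R) fun i => S.αTo2.onTerm (ts i)
  | _, BoundedFormula.imp θ₁ θ₂ => (relativizeBdd θ₁).imp (relativizeBdd θ₂)
  | n, BoundedFormula.all θ =>
      ((S.predA.boundedFormula₁ (Term.var (Sum.inr (Fin.last n)))).imp (relativizeBdd θ)).all

/-- The relativization `θ_A` of an `L_α`-formula `θ` to the predicate `A`. -/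
def relativize {γ : Type w} (θ : S.Lα.Formula γ) : S.L2.Formula γ := S.relativizeBdd θ

/-- The formula `A(x₁) ∧ ⋯ ∧ A(xₖ)`, where `xᵢ` is the variable `e i`. -/
noncomputable def allInA {L' : FirstOrder.Language} {γ : Type*} (A : L'.Relations 1) {k : ℕ}
    (e : Fin k → γ) : L'.Formula γ :=
  Formula.iInf fun i => A.formula₁ (Term.var (e i))

/-- `A` is closed under the function symbols of `L_α`. -/
def closureAxioms : S.L2.Theory :=
  {σ | ∃ (n : ℕ) (f : S.Lα.Functions n),
    σ = Formula.iAlls (α := Empty) (Fin n)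
      ((allInA S.predA Sum.inr).imp
        (S.predA.formula₁ (Term.func (S.αTo2.onFunction f) fun i => Term.var (Sum.inr i))))}

/-- The relations in `L_α \ L_β` hold only of tuples from `A`. -/
def supportAxioms : S.L2.Theory :=
  {σ | ∃ (n : ℕ) (R : S.alphaOnly n),
    σ = Formula.iAlls (α := Empty) (Fin n)
      ((Relations.formula (L := S.L2) (Sum.inr (ExtraRel.ofAlpha R)) fun i =>
        Term.var (Sum.inr i)).imp (allInA S.predA Sum.inr))}

/-- The theory `A(T_α)` of all relativizations of consequences of `T_α`. -/
def relTheory (Tα : S.Lα.Theory) : S.L2.Theory :=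
  {σ | ∃ φ : S.Lα.Sentence, Tα ⊨ᵇ φ ∧ σ = S.relativize φ}

/-- The theory `T²` of pairs. -/
def T2 (Tα : S.Lα.Theory) (Tβ : S.Lβ.Theory) : S.L2.Theory :=
  S.βTo2.onTheory Tβ ∪ S.relTheory Tα ∪ S.closureAxioms ∪ S.supportAxioms

variable {S}

theorem closureAxioms_closed {M : Type w} [S.L2.Structure M] (h : M ⊨ S.closureAxioms) {n : ℕ}
    (f : S.Lα.Functions n) (x : Fin n → M) (hx : ∀ i, x i ∈ S.setA M) :
    Structure.funMap f x ∈ S.setA M := by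
  have h1 := h.realize_of_mem _ ⟨n, f, rfl⟩
  rw [Sentence.Realize, Formula.realize_iAlls] at h1
  have h2 := h1 x
  rw [Formula.realize_imp, allInA, Formula.realize_iInf] at h2
  have h3 := h2 fun i => by
    rw [Formula.realize_rel₁]
    exact hx i
  rw [Formula.realize_rel₁] at h3
  exact h3

variable (S)

/-- The `L_α`-structure `𝒜` of a pair: the substructure with underlying set `A` of the reduct
to `L_α`. -/
def alphaPart (M : Type w) [S.L2.Structure M] (h : M ⊨ S.closureAxioms) :
    S.Lα.Substructure M where
  carrier := S.setA M
  fun_mem := fun f x hx => closureAxioms_closed h f x hx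

variable {S}

/-- A Mordell-Lang challenge `(p(x_α), q(x), φ(x, y), ψ(x_α, y))`, where `x = (x_i)_{i < n}`
and `x_α` is the subtuple with indices in `idx`. -/
structure Challenge (Tα : S.Lα.Theory) (Tβ : S.Lβ.Theory) where
  n : ℕ
  idx : Set (Fin n)
  p : Tα.CompleteType idx
  q : Tβ.CompleteType (Fin n)
  φ : S.Lβ.Formula (Fin n ⊕ Unit)
  ψ : S.Lα.Formula (idx ⊕ Unit)
  finite_of_realizes : ∀ (N : Theory.ModelType.{u, v, max u v} Tβ) (c : Fin n → N),
    RealizesType q c → {y : N | φ.Realize (Sum.elim c fun _ => y)}.Finite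

variable {Tα : S.Lα.Theory} {Tβ : S.Lβ.Theory}

/-- `c` is a contender in the pair `M`: the subtuple `c_α` of the components in `A` corresponds to
the variables `x_α`, `c` realizes `q`, `c_α` realizes `p_A`, and `c` and `A` are independent
over `c_α`. -/
structure Challenge.IsContender (X : Challenge Tα Tβ) (M : Type w) [S.L2.Structure M]
    (c : Fin X.n → M) : Prop where
  mem_iff : ∀ i, c i ∈ S.setA M ↔ i ∈ X.idx
  realizes_q : RealizesType X.q c
  realizes_p : ∀ θ : S.Lα.Formula X.idx, Formula.equivSentence θ ∈ X.p →
    (S.relativize θ).Realize fun i => c i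
  indep : IndependentOver (acl S.Lβ) (Set.range c) (S.setA M) (c '' X.idx)

/-- `(c, a)` is a solution in the pair `M`. -/
structure Challenge.IsSolution (X : Challenge Tα Tβ) (M : Type w) [S.L2.Structure M]
    (c : Fin X.n → M) (a : M) : Prop where
  contender : X.IsContender M c
  mem : a ∈ S.setA M
  realizes_φ : X.φ.Realize (Sum.elim c fun _ => a)
  realizes_ψ : (S.relativize X.ψ).Realize (Sum.elim (fun i => c i) fun _ => a)

variable (Tα Tβ) in
/-- The Mordell-Lang condition: every contender to a solvable challenge extends to a solution. -/
def MordellLangCondition (T : S.L2.Theory) : Prop :=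
  ∀ X : Challenge Tα Tβ,
    (∃ (M : Theory.ModelType.{u, v, max u v} T) (c : Fin X.n → M) (a : M), X.IsSolution M c a) →
    ∀ (M : Theory.ModelType.{u, v, max u v} T) (c : Fin X.n → M), X.IsContender M c →
      ∃ a : M, X.IsSolution M c a

/-- For a complete unary `L_β(C)`-type `q` and a complete unary `L_α(A ∩ C)`-type `p` computed
in `𝒜`, the type `q` contains all quantifier-free `L(A ∩ C)`-formulas of `p`. -/
def EntailsQF {M : Type w} [S.L2.Structure M] (h : M ⊨ S.closureAxioms) {C : Set M}
    (q : Set (S.Lβ.Formula (C ⊕ Fin 1)))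
    (p : Set (S.Lα.Formula ({a : S.alphaPart M h | (a : M) ∈ C} ⊕ Fin 1))) : Prop :=
  ∀ χ : S.common.Formula ({a : S.alphaPart M h | (a : M) ∈ C} ⊕ Fin 1),
    BoundedFormula.IsQF χ → S.commonToα.onFormula χ ∈ p →
      (S.commonToβ.onFormula χ).relabel
        (Sum.map (fun e => (⟨(e.1 : M), e.2⟩ : C)) (id : Fin 1 → Fin 1)) ∈ q

/-- The density condition for the pair `M` and the set of parameters `C`. -/
def DensityAt {M : Type w} [S.L2.Structure M] (h : M ⊨ S.closureAxioms) (C : Set M) : Prop :=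
  ∀ (q : Set (S.Lβ.Formula (C ⊕ Fin 1)))
    (p : Set (S.Lα.Formula ({a : S.alphaPart M h | (a : M) ∈ C} ⊕ Fin 1))),
    IsTypeOver q → NonAlgebraic q → IsTypeOver p → EntailsQF h q p →
      ∃ a ∈ S.setA M,
        (∀ θ ∈ p, (S.relativize θ).Realize (Sum.elim (fun e => ((e : S.alphaPart M h) : M))
          fun _ => a)) ∧
        RealizesTypeOver q fun _ => a

variable (S) in
/-- The codensity condition for the pair `M` and the set of parameters `C`. -/
def CodensityAt {M : Type w} [S.L2.Structure M] (C : Set M) : Prop :=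
  ∀ q : Set (S.Lβ.Formula (C ⊕ Fin 1)), IsTypeOver q → NonAlgebraic q →
    ∃ b : M, b ∉ acl S.Lβ (S.setA M ∪ C) ∧ RealizesTypeOver q fun _ => b

theorem model_closureAxioms {T : S.L2.Theory} (h : S.T2 Tα Tβ ⊆ T) (M : Type w)
    [S.L2.Structure M] [hM : M ⊨ T] : M ⊨ S.closureAxioms :=
  hM.mono fun _ hσ => h (Or.inl (Or.inr hσ))

variable (Tα Tβ) in
/-- `T` is a Mordell-Lang theory of pairs (for `T_α` and `T_β`). Here `|T²|` is the maximum of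
`ℵ₀` and the number of symbols of `L²`. -/
structure IsMLTheory (T : S.L2.Theory) : Prop where
  extends_T2 : S.T2 Tα Tβ ⊆ T
  mordellLang : MordellLangCondition Tα Tβ T
  density : ∀ (κ : Cardinal.{max u v}), max ℵ₀ S.L2.card < κ →
    ∀ M : Theory.ModelType.{u, v, max u v} T, IsSaturated S.L2 κ M →
      ∀ C : Set M, #C < κ → DensityAt (model_closureAxioms extends_T2 M) C
  codensity : ∀ (κ : Cardinal.{max u v}), max ℵ₀ S.L2.card < κ →
    ∀ M : Theory.ModelType.{u, v, max u v} T, IsSaturated S.L2 κ M →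
      ∀ C : Set M, #C < κ → S.CodensityAt C

/-- A special formula without parameters: `∃ x (A(x) ∧ ψ_A(x) ∧ φ(x, y))` with `ψ` an
`L_α`-formula and `φ` an `L_β`-formula. -/
def IsSpecial {γ : Type w} (θ : S.L2.Formula γ) : Prop :=
  ∃ (k : ℕ) (ψ : S.Lα.Formula (Fin k)) (φ : S.Lβ.Formula (γ ⊕ Fin k)),
    θ = Formula.iExs (Fin k)
      (allInA S.predA Sum.inr ⊓ (S.relativize ψ).relabel Sum.inr ⊓ S.βTo2.onFormula φ)

/-- A special formula with parameters from `C`: `∃ x (A(x) ∧ ψ_A(x) ∧ φ(x, y))` with `ψ` an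
`L_α`-formula and `φ` an `L_β(C)`-formula. -/
def IsSpecialOver {C : Type*} {γ : Type w} (θ : S.L2[[C]].Formula γ) : Prop :=
  ∃ (k : ℕ) (ψ : S.Lα.Formula (Fin k)) (φ : S.Lβ[[C]].Formula (γ ⊕ Fin k)),
    θ = Formula.iExs (Fin k)
      (allInA ((S.L2.lhomWithConstants C).onRelation S.predA) Sum.inr ⊓
        ((S.L2.lhomWithConstants C).onFormula (S.relativize ψ)).relabel Sum.inr ⊓
        (S.βTo2.addConstants C).onFormula φ)

end PairLanguage

end MLPairs

universe w'

/-! The proof is a back-and-forth between saturated models of `T`. Call a set free if it is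
independent from `A` over its part in `A` (`IsFreeOver`). A partial isomorphism (`IsPartialIso`)
matches two tuples with free ranges that have the same `L_β`-type, the same components in `A`, and,
on those components, the same `L_α`-type in `𝒜`. For finite tuples in saturated models it extends to
any further element `b`, possibly after other elements are added. If `b ∈ A` is not algebraic over
the tuple, density gives an image. If `b ∈ A` is algebraic, the Mordell-Lang condition gives an
image for each single pair of formulas, and saturation gives one for all pairs at once. If `b` is
not algebraic over `A` and the tuple, codensity gives an image. Otherwise `b` is algebraic over the
tuple and finitely many elements of `A`; once these and the relevant algebraic elements of `A` have
been added, any realization of the transferred `L_β`-type is an image. Hence partial isomorphisms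
are elementary (`IsPartialIso.realize_iff`).

Agreement on special formulas is enough to start this process (`exists_isPartialIso`). A finite
tuple becomes free when suitable finitely many elements of `A` are added. Special formulas say which
finite pieces of the type of such an extension are realized, so saturation copies the extension;
they also express algebraic dependence over `A`, so the copy is again free. Compactness
(`exists_isBoolComb_iff`) turns this into (a), and (b) follows by treating parameters as variables.

For (c), model completeness of both components makes special formulas persist under embeddings. Two
tuples with the same existential formulas can be identified by embedding one model into an
elementary extension of the other (`exists_amalgam`), so existential formulas decide special ones.
-/

namespace MLPairs

/-! ### Compactness for formulas with free variables -/

section Compactness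

variable {L : FirstOrder.Language.{u, v}}

/-- Compactness for sets of formulas with free variables. -/
theorem exists_realize_of_finite (T : L.Theory) {γ : Type w} (Γ : Set (L.Formula γ))
    (h : ∀ s ⊆ Γ, s.Finite → ∃ (M : Theory.ModelType.{u, v, w'} T) (x : γ → M),
      ∀ φ ∈ s, φ.Realize x) :
    ∃ (M : Theory.ModelType.{u, v, max u v w} T) (x : γ → M), ∀ φ ∈ Γ, φ.Realize x := by
  classical
  have hsat : ((L.lhomWithConstants γ).onTheory T ∪ Formula.equivSentence '' Γ).IsSatisfiable := by
    rw [Theory.isSatisfiable_iff_isFinitelySatisfiable]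
    intro T0 hT0
    obtain ⟨M, x, hx⟩ := h {φ ∈ Γ | Formula.equivSentence φ ∈ T0} (fun φ hφ => hφ.1)
      (Set.Finite.subset (T0.finite_toSet.preimage Formula.equivSentence.injective.injOn)
        fun φ hφ => hφ.2)
    let : (constantsOn γ).Structure M := constantsOn.structure x
    have hM : M ⊨ (L.lhomWithConstants γ).onTheory T :=
      (LHom.onTheory_model _ _).2 inferInstance
    have : M ⊨ (T0 : L[[γ]].Theory) := by
      refine ⟨fun σ hσ => ?_⟩
      rcases hT0 hσ with h1 | ⟨φ, hφ, rfl⟩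
      · exact hM.realize_of_mem _ h1
      · exact (Formula.realize_equivSentence _ _).2 (hx φ ⟨hφ, hσ⟩)
    exact Theory.Model.isSatisfiable M
  obtain ⟨M⟩ := hsat
  let := (L.lhomWithConstants γ).reduct M
  have h1 : M ⊨ (L.lhomWithConstants γ).onTheory T := M.is_model.mono Set.subset_union_left
  have : M ⊨ T := (LHom.onTheory_model _ _).1 h1
  refine ⟨Theory.ModelType.of T M, fun a => (L.con a : M), fun φ hφ => ?_⟩
  exact (Formula.realize_equivSentence (M := M) φ).1
    (M.is_model.realize_of_mem _ (Or.inr ⟨φ, hφ, rfl⟩))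

end Compactness

/-! ### Separation by boolean combinations -/

section BoolComb

variable {L : FirstOrder.Language.{u, v}}

theorem IsBoolComb.top {γ : Type w} {P : L.Formula γ → Prop} : IsBoolComb P ⊤ :=
  IsBoolComb.bot.not

theorem IsBoolComb.exists_conj {γ : Type w} {P : L.Formula γ → Prop} {s : Set (L.Formula γ)}
    (hs : s.Finite) (h : ∀ φ ∈ s, IsBoolComb P φ) (T : L.Theory) :
    ∃ χ : L.Formula γ, IsBoolComb P χ ∧ ∀ (M : Theory.ModelType.{u, v, max u v w} T)
      (x : γ → M), χ.Realize x ↔ ∀ φ ∈ s, φ.Realize x := by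
  induction s, hs using Set.Finite.induction_on with
  | empty => exact ⟨⊤, IsBoolComb.top, fun M x => by simp⟩
  | @insert φ s _ _ ih =>
    obtain ⟨χ, h1, h2⟩ := ih fun ψ hψ => h ψ (Or.inr hψ)
    refine ⟨φ ⊓ χ, (h φ (Or.inl rfl)).inf h1, fun M x => ?_⟩
    rw [Formula.realize_inf, h2, Set.forall_mem_insert]

/-- A formula whose truth depends only on the truth of the formulas in `P` is equivalent to a
boolean combination of formulas in `P`. -/
theorem exists_isBoolComb_iff (T : L.Theory) {γ : Type w} (P : L.Formula γ → Prop)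
    (φ : L.Formula γ)
    (h : ∀ (M N : Theory.ModelType.{u, v, max u v w} T) (x : γ → M) (y : γ → N),
      (∀ θ, P θ → (θ.Realize x ↔ θ.Realize y)) → φ.Realize x → φ.Realize y) :
    ∃ χ : L.Formula γ, IsBoolComb P χ ∧ φ ⇔[T] χ := by
  by_contra! hφ
  -- Some `y` satisfies `φ.not` and every boolean combination implied by `φ`; otherwise finitely
  -- many of these consequences would imply `φ`, and their conjunction would be equivalent to it.
  obtain ⟨N, y, hy⟩ := exists_realize_of_finite T
    ({χ | IsBoolComb P χ ∧ ∀ (M : Theory.ModelType.{u, v, max u v w} T) (x : γ → M),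
      φ.Realize x → χ.Realize x} ∪ {φ.not}) <| by
    intro s hs hfin
    by_contra! hcon
    obtain ⟨χ, h1, h2⟩ := IsBoolComb.exists_conj (P := P) (s := s \ {φ.not})
      (hfin.subset Set.sdiff_subset)
      (fun ψ hψ => ((hs hψ.1).resolve_right hψ.2).1) T
    refine hφ χ h1 fun M x xs => ?_
    rw [Unique.eq_default xs, BoundedFormula.realize_iff]
    constructor
    · intro hx
      exact (h2 M x).2 fun ψ hψ => ((hs hψ.1).resolve_right hψ.2).2 M x hx
    · intro hx
      by_contra hnx
      obtain ⟨ψ, hψ, hn⟩ := hcon M x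
      by_cases hψφ : ψ = φ.not
      · exact hn (hψφ ▸ hnx)
      · exact hn ((h2 M x).1 hx ψ ⟨hψ, hψφ⟩)
  -- Some `x` satisfies `φ` and every boolean combination true of `y`; otherwise `φ` implies the
  -- negation of a finite conjunction of these, and that negation would have to hold of `y`.
  obtain ⟨M, x, hx⟩ := exists_realize_of_finite T
    ({χ | IsBoolComb P χ ∧ χ.Realize y} ∪ {φ}) <| by
    intro s hs hfin
    by_contra! hcon
    obtain ⟨χ, h1, h2⟩ := IsBoolComb.exists_conj (P := P) (s := s \ {φ})
      (hfin.subset Set.sdiff_subset)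
      (fun ψ hψ => ((hs hψ.1).resolve_right hψ.2).1) T
    have : χ.not.Realize y := by
      refine hy _ (Or.inl ⟨h1.not, fun M x hx hχ => ?_⟩)
      obtain ⟨ψ, hψ, hn⟩ := hcon M x
      by_cases hψφ : ψ = φ
      · exact hn (hψφ ▸ hx)
      · exact hn ((h2 M x).1 hχ ψ ⟨hψ, hψφ⟩)
    exact this ((h2 N y).2 fun ψ hψ => ((hs hψ.1).resolve_right hψ.2).2)
  refine hy φ.not (Or.inr rfl) (h M N x y (fun θ hθ => ⟨fun hθx => ?_, fun hθy =>
    hx θ (Or.inl ⟨.basic hθ, hθy⟩)⟩) (hx φ (Or.inr rfl)))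
  by_contra hθy
  exact hx θ.not (Or.inl ⟨(IsBoolComb.basic hθ).not, hθy⟩) hθx

end BoolComb

end MLPairs

namespace MLPairs

/-! ### Construction of saturated models -/

section Saturation

/-- Every finitely satisfiable set of formulas in finitely many variables over fewer than `κ`
parameters is realized. -/
def IsPartialSaturated (L : FirstOrder.Language.{u, v}) (κ : Cardinal.{w}) (M : Type w)
    [L.Structure M] : Prop :=
  ∀ C : Set M, #C < κ → ∀ (n : ℕ) (p : Set (L.Formula (C ⊕ Fin n))),
    (∀ s ⊆ p, s.Finite →
      ∃ c : Fin n → M, ∀ φ ∈ s, φ.Realize (Sum.elim (fun e => (e : M)) c)) →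
    ∃ c : Fin n → M, RealizesTypeOver p c

/-- The back-and-forth realizes partial types directly; complete types are needed only to apply
density and codensity. -/
theorem IsPartialSaturated.isSaturated {L : FirstOrder.Language.{u, v}} {κ : Cardinal.{w}}
    {M : Type w} [L.Structure M] (h : IsPartialSaturated L κ M) : IsSaturated L κ M :=
  fun C hC n p hp => h C hC n p hp.finSat

/-- Names for the elements of a saturated structure: a name is a default point, a variable, or a
component of a realization of a partial type whose parameters are given by `P`-many names. -/
inductive Name (L : FirstOrder.Language.{u, v}) (P : Type (max u v)) (V : Type) : Type (max u v)
  | pt : Name L P V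
  | base : V → Name L P V
  | wit (n : ℕ) : Set (L.Formula (P ⊕ Fin n)) → (P → Name L P V) → Fin n → Name L P V

/-- A partial type with parameters given by names. -/
structure NameType (L : FirstOrder.Language.{u, v}) (P : Type (max u v)) (V : Type) :
    Type (max u v) where
  n : ℕ
  p : Set (L.Formula (P ⊕ Fin n))
  f : P → Name L P V

namespace NameType

variable {L : FirstOrder.Language.{u, v}} {P : Type (max u v)} {V : Type}

/-- The names of the components of the realization of a type. -/
def wit (t : NameType L P V) (i : Fin t.n) : Name L P V := Name.wit t.n t.p t.f i

/-- The second type has a component of the realization of the first type as a parameter. -/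
def Rel (t' t : NameType L P V) : Prop := ∃ j i, t.f j = t'.wit i

/-- Passing to a `Rel`-predecessor passes from a name to one of the names it is built from, so
structural induction on names applies. -/
theorem acc_of_wit (x : Name L P V) : ∀ (t : NameType L P V) (i : Fin t.n), x = t.wit i →
    Acc Rel t := by
  induction x with
  | pt => intro t i h; cases h
  | base a => intro t i h; cases h
  | wit n p f i ih =>
    rintro ⟨n', p', f'⟩ i' h
    cases h
    exact Acc.intro _ fun t' ⟨j, i'', h⟩ => ih j t' i'' h

instance isWellFounded_rel : IsWellFounded (NameType L P V) Rel :=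
  ⟨⟨fun t => Acc.intro _ fun t' ⟨j, i, h⟩ => acc_of_wit (t.f j) t' i h⟩⟩

/-- The formulas expressing that the type is realized by the names of its realization. -/
def formulas (t : NameType L P V) : Set (L.Formula (Name L P V)) :=
  (fun φ => φ.relabel (Sum.elim t.f t.wit)) '' t.p

noncomputable instance : LinearOrder (NameType L P V) :=
  IsWellFounded.wellOrderExtension Rel

instance : WellFoundedLT (NameType L P V) :=
  IsWellFounded.wellOrderExtension.isWellFounded_lt Rel

theorem lt_of_rel {t' t : NameType L P V} (h : Rel t' t) : t' < t :=
  Prod.Lex.left _ _ (IsWellFounded.rank_lt_of_rel h)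

/-- A set of formulas with free variables is satisfied in some model of `T`. -/
def Satisfiable (T : L.Theory) {γ : Type (max u v)} (Γ : Set (L.Formula γ)) : Prop :=
  ∃ (M : Theory.ModelType.{u, v, max u v} T) (x : γ → M), ∀ φ ∈ Γ, φ.Realize x

/-- The types that are realized in the construction of a saturated model of `T ∪ Γ`: run through
all types in order and accept those whose realization is consistent with what was accepted
before. -/
def Accepted (T : L.Theory) (Γ : Set (L.Formula (Name L P V))) : NameType L P V → Prop :=
  WellFounded.fix (wellFounded_lt (α := NameType L P V)) fun t ih =>
    Satisfiable T (Γ ∪ {φ | ∃ t', ∃ h : t' < t, ih t' h ∧ φ ∈ t'.formulas} ∪ t.formulas)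

theorem accepted_iff (T : L.Theory) (Γ : Set (L.Formula (Name L P V))) (t : NameType L P V) :
    Accepted T Γ t ↔ Satisfiable T
      (Γ ∪ {φ | ∃ t' < t, Accepted T Γ t' ∧ φ ∈ t'.formulas} ∪ t.formulas) := by
  rw [Accepted, WellFounded.fix_eq]
  simp only [exists_prop]

/-- Finitely many formulas come from finitely many accepted types, and acceptance of the largest of
these already says that all of them are jointly satisfiable. -/
theorem satisfiable_accepted (T : L.Theory) {Γ : Set (L.Formula (Name L P V))}
    (hΓ : Satisfiable T Γ) :
    Satisfiable T (Γ ∪ {φ | ∃ t, Accepted T Γ t ∧ φ ∈ t.formulas}) := by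
  classical
  refine exists_realize_of_finite T _ fun s hs hfin => ?_
  by_cases hsΓ : s ⊆ Γ
  · obtain ⟨M, x, hx⟩ := hΓ
    exact ⟨M, x, fun φ hφ => hx φ (hsΓ hφ)⟩
  have hsel : ∀ φ : (s \ Γ : Set _), ∃ t, Accepted T Γ t ∧ φ.1 ∈ t.formulas :=
    fun φ => (hs φ.2.1).resolve_left φ.2.2
  choose t ht using hsel
  have : Finite (s \ Γ : Set _) := hfin.subset Set.sdiff_subset
  have : Nonempty (s \ Γ : Set _) := by
    obtain ⟨φ, h1, h2⟩ := Set.not_subset.1 hsΓ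
    exact ⟨⟨φ, h1, h2⟩⟩
  obtain ⟨φ₀, hφ₀⟩ := Finite.exists_max t
  obtain ⟨M, x, hx⟩ := (accepted_iff T Γ _).1 (ht φ₀).1
  refine ⟨M, x, fun φ hφ => hx φ ?_⟩
  by_cases hφΓ : φ ∈ Γ
  · exact Or.inl (Or.inl hφΓ)
  have h1 := ht ⟨φ, hφ, hφΓ⟩
  rcases (hφ₀ ⟨φ, hφ, hφΓ⟩).lt_or_eq with h2 | h2
  · exact Or.inl (Or.inr ⟨_, h2, h1⟩)
  · exact Or.inr (h2 ▸ h1.2)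

/-- In a model of everything that was accepted, each finitely satisfiable type with parameters
given by names is realized by elements with names. -/
theorem exists_names {T : L.Theory} {Γ : Set (L.Formula V)}
    {N : Theory.ModelType.{u, v, max u v} T} {x : Name L P V → N}
    (hx : ∀ φ ∈ (fun φ : L.Formula V => φ.relabel Name.base) '' Γ ∪
      {φ | ∃ t : NameType L P V, Accepted T ((fun φ : L.Formula V => φ.relabel Name.base) '' Γ) t ∧
        φ ∈ t.formulas}, φ.Realize x)
    (t : NameType L P V)
    (ht : ∀ s ⊆ t.p, s.Finite → ∃ c : Fin t.n → N, ∀ φ ∈ s, φ.Realize (Sum.elim (x ∘ t.f) c)) :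
    ∃ c : Fin t.n → Name L P V, ∀ φ ∈ t.p, φ.Realize (Sum.elim (x ∘ t.f) (x ∘ c)) := by
  classical
  -- An accepted type is realized by its own names. Finite satisfiability in `N` will show that `t`
  -- is consistent with all that was accepted before it.
  suffices hacc : Accepted T ((fun φ : L.Formula V => φ.relabel Name.base) '' Γ) t by
    refine ⟨t.wit, fun φ hφ => ?_⟩
    have := hx _ (Or.inr ⟨t, hacc, φ, hφ, rfl⟩)
    rwa [Formula.realize_relabel, Sum.comp_elim] at this
  rw [accepted_iff]
  refine exists_realize_of_finite T _ fun s hs hfin => ?_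
  have hsel : ∀ ψ : (s ∩ t.formulas : Set _), ∃ φ ∈ t.p,
      φ.relabel (Sum.elim t.f t.wit) = ψ.1 := fun ψ => ψ.2.2
  choose g hgp hg using hsel
  have : Finite (s ∩ t.formulas : Set _) := hfin.subset Set.inter_subset_left
  obtain ⟨c, hc⟩ := ht (Set.range g) (Set.range_subset_iff.2 hgp) (Set.finite_range g)
  -- Only the names of the realization of `t` are reassigned. Neither `Γ` nor an earlier type
  -- mentions them, since a type with such a parameter comes after `t`; the parameters of `t` itself
  -- avoid them as well.
  let y : Name L P V → N := fun a => if h : ∃ i, a = t.wit i then c h.choose else x a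
  have hy : ∀ a, (∀ i, a ≠ t.wit i) → y a = x a := fun a ha => dif_neg fun ⟨i, hi⟩ => ha i hi
  have hyc : ∀ i, y (t.wit i) = c i := fun i => by
    have h : ∃ i', t.wit i = t.wit i' := ⟨i, rfl⟩
    have h2 : i = h.choose := by
      have h3 := h.choose_spec
      simp only [NameType.wit] at h3
      exact eq_of_heq (Name.wit.inj h3).2.2.2
    simp only [y, dif_pos h, ← h2]
  refine ⟨N, y, fun φ hφ => ?_⟩
  rcases hs hφ with (⟨ψ, hψ, rfl⟩ | ⟨t', ht', hacc, ψ, hψ, rfl⟩) | hφt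
  · have h1 := hx _ (Or.inl ⟨ψ, hψ, rfl⟩)
    simp only [Formula.realize_relabel] at h1 ⊢
    convert h1 using 1
    funext a
    exact hy _ fun i h => nomatch h
  · have h1 := hx _ (Or.inr ⟨t', hacc, ψ, hψ, rfl⟩)
    simp only [Formula.realize_relabel] at h1 ⊢
    convert h1 using 1
    funext a
    rcases a with j | i
    · exact hy _ fun i h => (lt_of_rel ⟨j, i, h⟩).asymm ht'
    · refine hy _ fun i' h => ht'.ne ?_
      simp only [Sum.elim_inr, NameType.wit] at h
      cases t; cases t'
      cases h
      rfl
  · have h1 := hc _ ⟨⟨φ, hφ, hφt⟩, rfl⟩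
    change φ.Realize y
    have h2 := hg ⟨φ, hφ, hφt⟩
    dsimp only at h2
    rw [← h2, Formula.realize_relabel]
    convert h1 using 1
    funext a
    rcases a with j | i
    · exact hy _ fun i h => (lt_of_rel (t' := t) (t := t) ⟨j, i, h⟩).false
    · exact hyc i

/-- A version of `exists_names` for parameters indexed by any type that is not larger than `P`. -/
theorem exists_names_of_embedding {T : L.Theory} {Γ : Set (L.Formula V)}
    {N : Theory.ModelType.{u, v, max u v} T} {x : Name L P V → N}
    (hx : ∀ φ ∈ (fun φ : L.Formula V => φ.relabel Name.base) '' Γ ∪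
      {φ | ∃ t : NameType L P V, Accepted T ((fun φ : L.Formula V => φ.relabel Name.base) '' Γ) t ∧
        φ ∈ t.formulas}, φ.Realize x)
    {C : Type w} (e : C ↪ P) (f : C → Name L P V) {n : ℕ} (p : Set (L.Formula (C ⊕ Fin n)))
    (hp : ∀ s ⊆ p, s.Finite → ∃ c : Fin n → N, ∀ φ ∈ s, φ.Realize (Sum.elim (x ∘ f) c)) :
    ∃ c : Fin n → Name L P V, ∀ φ ∈ p, φ.Realize (Sum.elim (x ∘ f) (x ∘ c)) := by
  classical
  -- The value `pt` fills the places outside the image of `e`, which no relabelled formula mentions.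
  let F : P → Name L P V := Function.extend e f fun _ => Name.pt
  have hF : F ∘ e = f := funext fun a => e.injective.extend_apply f (fun _ => Name.pt) a
  have key : ∀ (φ : L.Formula (C ⊕ Fin n)) (c : Fin n → N),
      (φ.relabel (Sum.map e id)).Realize (Sum.elim (x ∘ F) c) ↔
        φ.Realize (Sum.elim (x ∘ f) c) := fun φ c => by
    rw [Formula.realize_relabel, Sum.elim_comp_map, Function.comp_assoc, hF, Function.comp_id]
  obtain ⟨c, hc⟩ := exists_names hx ⟨n, (fun φ => φ.relabel (Sum.map e id)) '' p, F⟩ <| by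
    intro s hs hfin
    have hsel : ∀ ψ : s, ∃ φ ∈ p, φ.relabel (Sum.map e id) = ψ.1 := fun ψ => hs ψ.2
    choose g hgp hg using hsel
    have : Finite s := hfin
    obtain ⟨c, hc⟩ := hp (Set.range g) (Set.range_subset_iff.2 hgp) (Set.finite_range g)
    refine ⟨c, fun ψ hψ => ?_⟩
    have h1 := (key _ _).2 (hc _ ⟨⟨ψ, hψ⟩, rfl⟩)
    rwa [hg] at h1
  exact ⟨c, fun φ hφ => (key φ _).1 (hc _ ⟨φ, hφ, rfl⟩)⟩

end NameType

open NameType in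
/-- A set of formulas that is satisfied in a model of `T` is satisfied in a `κ`-saturated model
of `T`, for each infinite successor cardinal `κ`. -/
theorem exists_saturated {L : FirstOrder.Language.{u, v}} {T : L.Theory} (P : Type (max u v))
    [Infinite P] {V : Type} (Γ : Set (L.Formula V)) (M : Theory.ModelType.{u, v, max u v} T)
    (c : V → M) (hc : ∀ φ ∈ Γ, φ.Realize c) :
    ∃ (K : Theory.ModelType.{u, v, max u v} T) (d : V → K), (∀ φ ∈ Γ, φ.Realize d) ∧
      IsPartialSaturated L (Order.succ #P) K := by
  classical
  obtain ⟨N, x, hx⟩ := satisfiable_accepted (P := P) T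
    (Γ := (fun φ : L.Formula V => φ.relabel Name.base) '' Γ) <| by
      refine ⟨M, fun a => match a with
        | .base i => c i
        | _ => Classical.arbitrary M, ?_⟩
      rintro _ ⟨φ, hφ, rfl⟩
      rw [Formula.realize_relabel]
      exact hc φ hφ
  have hfin : ∀ n : ℕ, Nonempty (Fin n ↪ P) := fun n =>
    ⟨Fin.valEmbedding.trans (Infinite.natEmbedding P)⟩
  -- This is the Tarski-Vaught criterion for the set of named elements: a single satisfiable formula
  -- is a finitely satisfiable type.
  have tv : ∀ (n : ℕ) (φ : L.Formula (Fin n ⊕ Fin 1)) (f : Fin n → Name L P V) (a : N),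
      φ.Realize (Sum.elim (x ∘ f) fun _ => a) →
        ∃ b, φ.Realize (Sum.elim (x ∘ f) fun _ => x b) := by
    intro n φ f a h
    obtain ⟨c, hc⟩ := exists_names_of_embedding hx (hfin n).some f {φ} fun s hs _ =>
      ⟨fun _ => a, fun ψ hψ => by rwa [hs hψ]⟩
    refine ⟨c 0, ?_⟩
    convert hc φ rfl using 2
    funext i
    rw [Subsingleton.elim i 0]
    rfl
  let K₀ : L.Substructure N :=
    { carrier := Set.range x
      fun_mem := by
        intro n g y hy
        choose f hf using hy
        obtain ⟨b, hb⟩ := tv n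
          (Term.equal (Term.var (Sum.inr 0)) (Term.func g fun i => Term.var (Sum.inl i))) f
          (Structure.funMap g y) (by
            rw [Formula.realize_equal]
            simp [hf])
        refine ⟨b, ?_⟩
        rw [Formula.realize_equal] at hb
        simpa [hf] using hb }
  let K : L.ElementarySubstructure N := K₀.toElementarySubstructure <| by
    intro n φ y a h
    choose f hf using fun i => (y i).2
    let g : Empty ⊕ Fin (n + 1) → Fin n ⊕ Fin 1 :=
      Sum.elim Empty.elim (Fin.snoc (α := fun _ => Fin n ⊕ Fin 1) Sum.inl (Sum.inr 0))
    have key : ∀ b : N, (φ.toFormula.relabel g).Realize (Sum.elim (x ∘ f) fun _ => b) ↔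
        φ.Realize default (Fin.snoc ((↑) ∘ y) b : _ → N) := by
      intro b
      rw [Formula.realize_relabel, BoundedFormula.realize_toFormula]
      have h1 : (Sum.elim (x ∘ f) fun _ => b) ∘ g ∘ Sum.inr = (Fin.snoc ((↑) ∘ y) b : _ → N) := by
        funext i
        refine Fin.lastCases ?_ (fun i => ?_) i
        · simp [g]
        · simp [g, hf]
      rw [← h1]
      convert Iff.rfl using 2
      rfl
    obtain ⟨b, hb⟩ := tv n (φ.toFormula.relabel g) f a ((key a).2 h)
    exact ⟨⟨x b, b, rfl⟩, (key _).1 hb⟩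
  refine ⟨Theory.ModelType.of T K, fun i => ⟨x (Name.base i), _, rfl⟩, fun φ hφ => ?_, ?_⟩
  · refine (K.subtype.map_formula φ _).1 ?_
    have h1 := hx _ (Or.inl ⟨φ, hφ, rfl⟩)
    rw [Formula.realize_relabel] at h1
    exact h1
  · intro C hC n p hp
    -- Below the successor of `#P`, every parameter set can be indexed by `P`, so one name handles
    -- it; neither a chain of extensions nor a bound on the size of `K` is needed.
    obtain ⟨e⟩ : Nonempty (C ↪ P) := Cardinal.le_def _ _ |>.1 (Order.lt_succ_iff.1 hC)
    choose f hf using fun i : C => i.1.2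
    have key : ∀ (φ : L.Formula (C ⊕ Fin n)) (y : Fin n → K),
        φ.Realize (Sum.elim (x ∘ f) fun i => (y i : N)) ↔
          φ.Realize (Sum.elim (fun i : C => (show K from i.1)) y) := by
      intro φ y
      rw [← K.subtype.map_formula]
      congr! 1
      funext i
      rcases i with i | i
      · exact hf i
      · rfl
    obtain ⟨b, hb⟩ := exists_names_of_embedding hx e f p <| by
      intro s hs hsfin
      obtain ⟨y, hy⟩ := hp s hs hsfin
      exact ⟨fun i => ((show K from y i) : N), fun φ hφ => (key φ y).2 (hy φ hφ)⟩
    exact ⟨fun i => ⟨x (b i), _, rfl⟩, fun φ hφ => (key φ _).1 (hb φ hφ)⟩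

end Saturation
end MLPairs

namespace MLPairs

/-! ### Independence in pregeometries -/

section Pregeometry

variable {M : Type w} {cl : Set M → Set M}

theorem IsPregeometry.cl_subset_cl (h : IsPregeometry cl) {X Y : Set M} (hXY : X ⊆ cl Y) :
    cl X ⊆ cl Y :=
  (h.mono _ _ hXY).trans (h.idem Y).le

theorem ClIndependent.mono (h : IsPregeometry cl) {X Y Z W : Set M} (hX : ClIndependent cl X Z)
    (hY : Y ⊆ X) (hW : W ⊆ cl Z) : ClIndependent cl Y W := by
  intro y hy hcl
  refine hX y (hY hy) (h.cl_subset_cl (Set.union_subset ?_ ?_) hcl)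
  · exact hW.trans (h.mono _ _ Set.subset_union_left)
  · exact (Set.subset_union_right.trans' (Set.sdiff_subset_sdiff_left hY)).trans (h.subset_cl _)

/-- Symmetry of independence. -/
theorem ClIndependent.symm (h : IsPregeometry cl) {U V Z : Set M} (hU : ClIndependent cl U Z)
    (hV : ClIndependent cl V (Z ∪ U)) : ClIndependent cl U (Z ∪ V) := by
  classical
  intro u hu hcl
  have hfin : ∃ F : Finset M, ↑F ⊆ V ∧ u ∈ cl (Z ∪ F ∪ U \ {u}) := by
    obtain ⟨Y, hY, hYf, huY⟩ := h.finitary _ _ hcl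
    refine ⟨(hYf.inter_of_left V).toFinset, by simp, h.mono _ _ (fun y hy => ?_) huY⟩
    rcases hY hy with (h1 | h1) | h1
    · exact Or.inl (Or.inl h1)
    · exact Or.inl (Or.inr (by simpa using ⟨hy, h1⟩))
    · exact Or.inr h1
  have key : ∀ F : Finset M, ↑F ⊆ V → u ∉ cl (Z ∪ F ∪ U \ {u}) := by
    intro F
    induction F using Finset.induction_on with
    | empty => simpa using hU u hu
    | @insert v F hvF ih =>
      intro hF hcl
      rw [Finset.coe_insert, Set.insert_subset_iff] at hF
      refine hV v hF.1 ?_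
      -- If adding `v` is what makes `u` dependent, exchange makes `v` dependent on `Z ∪ U` and the
      -- rest of `V`, against `hV`.
      have h1 : v ∈ cl (insert u (Z ∪ F ∪ U \ {u})) := by
        refine h.exchange _ _ _ (h.mono _ _ ?_ hcl) (ih hF.2)
        rw [Finset.coe_insert]
        rintro y ((hy | rfl | hy) | hy)
        · exact Or.inr (Or.inl (Or.inl hy))
        · exact Or.inl rfl
        · exact Or.inr (Or.inl (Or.inr hy))
        · exact Or.inr (Or.inr hy)
      refine h.mono _ _ ?_ h1
      rintro y (rfl | (hy | hy) | hy)
      · exact Or.inl (Or.inr hu)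
      · exact Or.inl (Or.inl hy)
      · exact Or.inr ⟨hF.2 hy, fun h2 => hvF (by rw [← Set.mem_singleton_iff.1 h2]; exact hy)⟩
      · exact Or.inl (Or.inr hy.1)
  obtain ⟨F, hF, hu'⟩ := hfin
  exact key F hF hu'

theorem ClIndependent.insert (h : IsPregeometry cl) {X Z : Set M} {b : M}
    (hX : ClIndependent cl X Z) (hb : b ∉ cl (Z ∪ X)) : ClIndependent cl (insert b X) Z := by
  have hbX : b ∉ X := fun hbX => hb (h.subset_cl _ (Or.inr hbX))
  have h1 : ClIndependent cl {b} (Z ∪ X) := by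
    rintro _ rfl
    simpa using hb
  have h2 := hX.symm h h1
  rintro x (rfl | hx) hcl
  · refine hb (h.mono _ _ (Set.union_subset_union_right _ ?_) hcl)
    rintro y ⟨rfl | hy, hyx⟩
    · exact absurd rfl hyx
    · exact hy
  · refine h2 x hx (h.mono _ _ ?_ hcl)
    rintro y (hy | ⟨rfl | hy, hyx⟩)
    · exact Or.inl (Or.inl hy)
    · exact Or.inl (Or.inr rfl)
    · exact Or.inr ⟨hy, hyx⟩

/-- Each set has a basis over each other set. -/
theorem IsPregeometry.exists_basis (h : IsPregeometry cl) (Y Z : Set M) :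
    ∃ X ⊆ Y, ClIndependent cl X Z ∧ Y ⊆ cl (Z ∪ X) := by
  obtain ⟨X, hX⟩ := zorn_subset {X | X ⊆ Y ∧ ClIndependent cl X Z} <| by
    intro c hc hchain
    refine ⟨⋃₀ c, ⟨Set.sUnion_subset fun X hX => (hc hX).1, ?_⟩,
      fun X hX => Set.subset_sUnion_of_mem hX⟩
    rintro x ⟨X, hX, hxX⟩ hcl
    obtain ⟨F, hF, hfin, hx⟩ := h.finitary _ _ hcl
    have : ∃ W ∈ c, F ∪ {x} ⊆ Z ∪ W := by
      -- A dependence is witnessed by a finite set, which a single member of the chain contains up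
      -- to elements of `Z`.
      have hsub : (F ∪ {x}) \ Z ⊆ ⋃₀ c := by
        rintro y ⟨hy | rfl, hyZ⟩
        · exact ((hF hy).resolve_left hyZ).1
        · exact ⟨X, hX, hxX⟩
      obtain ⟨W, hW, hFW⟩ := hchain.directedOn.exists_mem_subset_of_finite_of_subset_sUnion
        ⟨X, hX⟩ ((hfin.union (Set.finite_singleton x)).subset Set.sdiff_subset) hsub
      exact ⟨W, hW, Set.sdiff_subset_iff.1 hFW⟩
    obtain ⟨W, hW, hFW⟩ := this
    by_cases hxW : x ∈ W
    · refine (hc hW).2 x hxW (h.mono _ _ (fun y hy => ?_) hx)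
      rcases hF hy with h1 | h1
      · exact Or.inl h1
      · exact (hFW (Or.inl hy)).imp id fun h2 => ⟨h2, h1.2⟩
    · exact (hc hX).2 x hxX (h.subset_cl _ (Or.inl ((hFW (Or.inr rfl)).resolve_right hxW)))
  refine ⟨X, hX.prop.1, hX.prop.2, fun y hy => ?_⟩
  by_contra hcl
  have h1 : Insert.insert y X ⊆ X :=
    hX.le_of_ge ⟨Set.insert_subset hy hX.prop.1, hX.prop.2.insert h hcl⟩ (Set.subset_insert _ _)
  exact hcl (h.subset_cl _ (Or.inr (h1 (Or.inl rfl))))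

/-- Symmetry is used twice: a basis `Y₀` of `Y` over `Z` is independent over `Z ∪ B`, hence over `Z
∪ X₀`, and then `X₀` is independent over `Z ∪ Y₀`, whose closure contains `Y`. -/
theorem IndependentOver.of_basis (h : IsPregeometry cl) {B X Y Z : Set M}
    (hX : X ⊆ cl (B ∪ Z)) (hB : ClIndependent cl B (Y ∪ Z)) : IndependentOver cl X Y Z := by
  intro X₀ hX₀ hind
  obtain ⟨Y₀, hY₀, hY₀Z, hY⟩ := h.exists_basis Y Z
  have h1 : ClIndependent cl B (Z ∪ Y₀) := by
    refine hB.mono h subset_rfl (Set.union_subset ?_ ?_)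
    · exact Set.subset_union_right.trans (h.subset_cl _)
    · exact (hY₀.trans Set.subset_union_left).trans (h.subset_cl _)
  have h2 : ClIndependent cl Y₀ (Z ∪ B) := hY₀Z.symm h h1
  have h3 : ClIndependent cl Y₀ (Z ∪ X₀) := by
    refine h2.mono h subset_rfl (Set.union_subset ?_ ?_)
    · exact Set.subset_union_left.trans (h.subset_cl _)
    · rw [Set.union_comm]
      exact hX₀.trans hX
  refine (hind.symm h h3).mono h subset_rfl (Set.union_subset hY ?_)
  exact Set.subset_union_left.trans (h.subset_cl _)

/-- The set `X` is independent from `A` over `X ∩ A`, as witnessed by a basis. -/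
def IsFreeOver (cl : Set M → Set M) (X A : Set M) : Prop :=
  ∃ B ⊆ X, X ⊆ cl (B ∪ X ∩ A) ∧ ClIndependent cl B A

theorem IsFreeOver.independentOver (h : IsPregeometry cl) {X A : Set M}
    (hX : IsFreeOver cl X A) : IndependentOver cl X A (X ∩ A) := by
  obtain ⟨B, -, h1, h2⟩ := hX
  exact .of_basis h h1 (by rwa [Set.union_eq_left.2 Set.inter_subset_right])

theorem IsFreeOver.insert_of_mem (h : IsPregeometry cl) {X A : Set M} {b : M}
    (hX : IsFreeOver cl X A) (hb : b ∈ A ∪ cl X) : IsFreeOver cl (insert b X) A := by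
  obtain ⟨B, hBX, h1, h2⟩ := hX
  have h3 : X ⊆ cl (B ∪ Insert.insert b X ∩ A) :=
    h1.trans (h.mono _ _ (Set.union_subset_union_right _
      (Set.inter_subset_inter_left _ (Set.subset_insert _ _))))
  refine ⟨B, hBX.trans (Set.subset_insert _ _), Set.insert_subset ?_ h3, h2⟩
  rcases hb with hb | hb
  · exact h.subset_cl _ (Or.inr ⟨Or.inl rfl, hb⟩)
  · exact h.cl_subset_cl h3 hb

theorem IsFreeOver.insert_of_notMem (h : IsPregeometry cl) {X A : Set M} {b : M}
    (hX : IsFreeOver cl X A) (hb : b ∉ cl (A ∪ X)) : IsFreeOver cl (insert b X) A := by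
  obtain ⟨B, hBX, h1, h2⟩ := hX
  refine ⟨Insert.insert b B, Set.insert_subset_insert hBX, Set.insert_subset ?_ ?_, h2.insert h
    fun h3 => hb (h.mono _ _ (Set.union_subset_union_right _ hBX) h3)⟩
  · exact h.subset_cl _ (Or.inl (Or.inl rfl))
  · exact h1.trans (h.mono _ _ (Set.union_subset_union (Set.subset_insert _ _)
      (Set.inter_subset_inter_left _ (Set.subset_insert _ _))))

end Pregeometry

end MLPairs

namespace MLPairs

/-! ### Algebraicity and transfer of types -/

section Types

variable {L : FirstOrder.Language.{u, v}}

/-- Two tuples satisfy the same `L`-formulas. -/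
def SameType (L : FirstOrder.Language.{u, v}) {ι : Type*} {M N : Type*} [L.Structure M]
    [L.Structure N] (c : ι → M) (d : ι → N) : Prop :=
  ∀ φ : L.Formula ι, φ.Realize c ↔ φ.Realize d

section

variable {ι η : Type*} {M N : Type*} [L.Structure M] [L.Structure N] {c : ι → M} {d : ι → N}

theorem SameType.symm (h : SameType L c d) : SameType L d c := fun φ => (h φ).symm

theorem SameType.comp (h : SameType L c d) (e : η → ι) : SameType L (c ∘ e) (d ∘ e) :=
  fun φ => by
    have h1 := h (φ.relabel e)
    rwa [Formula.realize_relabel, Formula.realize_relabel] at h1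

theorem SameType.eq_iff (h : SameType L c d) {i j : ι} : c i = c j ↔ d i = d j := by
  simpa [Formula.realize_equal] using h (Term.equal (Term.var i) (Term.var j))

/-- `φ(x, y)` has at least `m` solutions `y`. -/
noncomputable def atLeast (m : ℕ) (φ : L.Formula (ι ⊕ Unit)) : L.Formula ι :=
  Formula.iExs (Fin m) ((Formula.iInf fun p : {p : Fin m × Fin m // p.1 ≠ p.2} =>
    (Term.equal (Term.var (Sum.inr p.1.1)) (Term.var (Sum.inr p.1.2))).not) ⊓
      Formula.iInf fun i => φ.relabel (Sum.map id fun _ => i))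

theorem realize_atLeast {m : ℕ} {φ : L.Formula (ι ⊕ Unit)} :
    (atLeast m φ).Realize c ↔ ∃ f : Fin m → M, Function.Injective f ∧
      ∀ i, φ.Realize (Sum.elim c fun _ => f i) := by
  simp only [atLeast, Formula.realize_iExs, Formula.realize_inf, Formula.realize_iInf,
    Formula.realize_not, Formula.realize_equal, Term.realize_var, Formula.realize_relabel,
    Sum.elim_comp_map, Sum.elim_inr, Subtype.forall, Prod.forall, Function.comp_id]
  refine exists_congr fun f => and_congr ⟨fun h i j hij => ?_, fun h i j hij => h.ne hij⟩ Iff.rfl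
  by_contra hne
  exact h i j hne hij

theorem infinite_iff_atLeast {φ : L.Formula (ι ⊕ Unit)} :
    {y | φ.Realize (Sum.elim c fun _ => y)}.Infinite ↔ ∀ m, (atLeast m φ).Realize c := by
  simp only [realize_atLeast]
  constructor
  · intro h m
    let e := h.natEmbedding
    exact ⟨fun i => e i, fun i j hij => Fin.ext (e.injective (Subtype.ext hij)), fun i => (e i).2⟩
  · intro h hfin
    obtain ⟨f, hf, hfS⟩ := h (hfin.toFinset.card + 1)
    have h1 := Finset.card_le_card_of_injOn (s := Finset.univ) (t := hfin.toFinset) f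
      (fun i _ => by simpa using hfS i) hf.injOn
    simp at h1

/-- `φ(x, y)` holds and has fewer than `m` solutions `y`. -/
noncomputable def fewer (m : ℕ) (φ : L.Formula (ι ⊕ Unit)) : L.Formula (ι ⊕ Unit) :=
  φ ⊓ (atLeast m φ).not.relabel Sum.inl

theorem realize_fewer {m : ℕ} {φ : L.Formula (ι ⊕ Unit)} {b : M} :
    (fewer m φ).Realize (Sum.elim c fun _ => b) ↔ φ.Realize (Sum.elim c fun _ => b) ∧
      ¬ (atLeast m φ).Realize c := by
  rw [fewer, Formula.realize_inf, Formula.realize_relabel, Sum.elim_comp_inl, Formula.realize_not]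

theorem finite_fewer (m : ℕ) (φ : L.Formula (ι ⊕ Unit)) (c : ι → M) :
    {y | (fewer m φ).Realize (Sum.elim c fun _ => y)}.Finite := by
  by_contra h
  have h1 : ¬ (atLeast m φ).Realize c := by
    obtain ⟨y, hy⟩ := Set.Infinite.nonempty h
    exact (realize_fewer.1 hy).2
  exact h1 (infinite_iff_atLeast.1 (Set.Infinite.mono (fun y hy => (realize_fewer.1 hy).1) h) m)

/-- Since `fewer m φ` carries its own bound on the number of solutions, algebraicity is witnessed by
the truth of one formula, which can be moved to another structure. -/
theorem mem_acl_range_iff {b : M} : b ∈ acl L (Set.range c) ↔ ∃ (m : ℕ) (φ : L.Formula (ι ⊕ Unit)),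
    (fewer m φ).Realize (Sum.elim c fun _ => b) := by
  constructor
  · rintro ⟨s, hs, hfin, hb⟩
    obtain ⟨φ, hφ⟩ := Set.definable_iff_exists_formula_sum.1 hs
    have hmem : ∀ y, y ∈ s ↔ (φ.relabel (Sum.map (Set.rangeSplitting c) fun _ => ())).Realize
        (Sum.elim c fun _ => y) := by
      intro y
      have h1 : (fun _ : Fin 1 => y) ∈ {x : Fin 1 → M | x 0 ∈ s} ↔ y ∈ s := Iff.rfl
      rw [← h1, hφ, Formula.realize_relabel, Sum.elim_comp_map]
      have h2 : c ∘ Set.rangeSplitting c = (fun x : Set.range c => (x : M)) :=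
        funext fun x => Set.apply_rangeSplitting c x
      rw [h2]
      rfl
    have h3 : ¬ {y | (φ.relabel (Sum.map (Set.rangeSplitting c) fun _ => ())).Realize
        (Sum.elim c fun _ => y)}.Infinite := by
      simpa only [← hmem, Set.not_infinite] using! hfin
    rw [infinite_iff_atLeast, not_forall] at h3
    obtain ⟨m, hm⟩ := h3
    exact ⟨m, _, realize_fewer.2 ⟨(hmem b).1 hb, hm⟩⟩
  · rintro ⟨m, φ, hb⟩
    refine ⟨{y | (fewer m φ).Realize (Sum.elim c fun _ => y)}, ?_, finite_fewer m φ c, hb⟩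
    refine Set.definable_iff_exists_formula_sum.2
      ⟨(fewer m φ).relabel (Sum.map (Set.rangeFactorization c) fun _ => 0), ?_⟩
    ext x
    simp only [Set.mem_ofPred_eq, Formula.realize_relabel, Sum.elim_comp_map]
    rfl

theorem SameType.mem_acl {b : M} {b' : N}
    (h : SameType L (Sum.elim c fun _ : Unit => b) (Sum.elim d fun _ : Unit => b'))
    (hb : b ∈ acl L (Set.range c)) : b' ∈ acl L (Set.range d) := by
  obtain ⟨m, φ, hφ⟩ := mem_acl_range_iff.1 hb
  exact mem_acl_range_iff.2 ⟨m, φ, (h _).1 hφ⟩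

theorem SameType.exists_realize (h : SameType L c d) [Finite η] {φ : L.Formula (ι ⊕ η)} {b : η → M}
    (hb : φ.Realize (Sum.elim c b)) : ∃ b', φ.Realize (Sum.elim d b') := by
  rw [← Formula.realize_iExs, ← h, Formula.realize_iExs]
  exact ⟨b, hb⟩

/-- The type of `b` over `c`, transferred to the corresponding tuple. -/
def transferType {D : Set N} (c' : D → M) (b : M) : Set (L.Formula (D ⊕ Fin 1)) :=
  {φ | φ.Realize (Sum.elim c' fun _ => b)}

variable {D : Set N} {c' : D → M}

theorem isTypeOver_transferType (h : SameType L c' (fun x : D => (x : N))) (b : M) :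
    IsTypeOver (transferType (L := L) c' b) where
  finSat s hs hfin := by
    have : Finite s := hfin
    have h1 : (Formula.iInf fun φ : s => φ.1).Realize (Sum.elim c' fun _ : Fin 1 => b) := by
      rw [Formula.realize_iInf]
      exact fun φ => hs φ.2
    obtain ⟨y, hy⟩ := h.exists_realize h1
    rw [Formula.realize_iInf] at hy
    exact ⟨y, fun φ hφ => hy ⟨φ, hφ⟩⟩
  complete φ := by
    by_cases hφ : φ.Realize (Sum.elim c' fun _ => b)
    · exact Or.inl hφ
    · exact Or.inr hφ

/-- The formulas `atLeast m φ` concern the parameters only, so a failure in `N` would be a failure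
in `M` and would make `b` algebraic. -/
theorem nonAlgebraic_transferType (h : SameType L c' (fun x : D => (x : N))) {b : M}
    (hb : b ∉ acl L (Set.range c')) : NonAlgebraic (transferType (L := L) c' b) := by
  intro φ hφ
  have key : ∀ y : N, (φ.relabel (Sum.map id fun _ => ()) : L.Formula (D ⊕ Unit)).Realize
      (Sum.elim (fun x : D => (x : N)) fun _ => y) ↔
      φ.Realize (Sum.elim (fun x : D => (x : N)) fun _ => y) := fun y => by
    rw [Formula.realize_relabel, Sum.elim_comp_map]
    rfl
  simp only [← key]
  rw [infinite_iff_atLeast]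
  intro m
  rw [← h]
  by_contra hm
  refine hb (mem_acl_range_iff.2 ⟨m, _, realize_fewer.2 ⟨?_, hm⟩⟩)
  rw [Formula.realize_relabel, Sum.elim_comp_map]
  exact hφ

end

/-- A directed family of formulas over a finite tuple is realized in a saturated structure if each
of its members is. -/
theorem IsPartialSaturated.exists_realize {κ : Cardinal.{w}} {M : Type w} [L.Structure M]
    (h : IsPartialSaturated L κ M) (hκ : ℵ₀ ≤ κ) {ι η : Type} [Finite ι] [Finite η] (d : ι → M)
    (Γ : Set (L.Formula (ι ⊕ η))) (hne : Γ.Nonempty)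
    (hdir : ∀ φ ∈ Γ, ∀ ψ ∈ Γ, ∃ χ ∈ Γ, ∀ y, χ.Realize (Sum.elim d y) →
      φ.Realize (Sum.elim d y) ∧ ψ.Realize (Sum.elim d y))
    (hsat : ∀ φ ∈ Γ, ∃ y, φ.Realize (Sum.elim d y)) :
    ∃ y, ∀ φ ∈ Γ, φ.Realize (Sum.elim d y) := by
  have hfin : ∀ s : Set (L.Formula (ι ⊕ η)), s.Finite → s ⊆ Γ → ∃ χ ∈ Γ, ∀ y,
      χ.Realize (Sum.elim d y) → ∀ φ ∈ s, φ.Realize (Sum.elim d y) := by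
    intro s hs
    induction s, hs using Set.Finite.induction_on with
    | empty =>
      obtain ⟨χ, hχ⟩ := hne
      exact fun _ => ⟨χ, hχ, fun _ _ _ h => h.elim⟩
    | @insert φ s _ _ ih =>
      intro hsub
      rw [Set.insert_subset_iff] at hsub
      obtain ⟨χ, hχ, h1⟩ := ih hsub.2
      obtain ⟨θ, hθ, h2⟩ := hdir φ hsub.1 χ hχ
      refine ⟨θ, hθ, fun y hy => ?_⟩
      rw [Set.forall_mem_insert]
      exact ⟨(h2 y hy).1, h1 y (h2 y hy).2⟩
  obtain ⟨n, ⟨e⟩⟩ := Finite.exists_equiv_fin η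
  have key : ∀ (φ : L.Formula (ι ⊕ η)) (y : Fin n → M),
      (φ.relabel (Sum.map (Set.rangeFactorization d) e)).Realize
        (Sum.elim (fun x : Set.range d => (x : M)) y) ↔ φ.Realize (Sum.elim d (y ∘ e)) :=
    fun φ y => by
      rw [Formula.realize_relabel, Sum.elim_comp_map]
      rfl
  obtain ⟨y, hy⟩ := h (Set.range d) ((Cardinal.lt_aleph0_of_finite _).trans_le hκ) n
    ((fun φ => φ.relabel (Sum.map (Set.rangeFactorization d) e)) '' Γ) <| by
      intro s hs hsfin
      obtain ⟨t, ht, htfin, rfl⟩ : ∃ t ⊆ Γ, t.Finite ∧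
          (fun φ => φ.relabel (Sum.map (Set.rangeFactorization d) e)) '' t = s := by
        exact Set.exists_subset_image_finite_and (p := (· = s)).1 ⟨s, hs, hsfin, rfl⟩
      obtain ⟨χ, hχ, h1⟩ := hfin t htfin ht
      obtain ⟨y, hy⟩ := hsat χ hχ
      refine ⟨y ∘ e.symm, ?_⟩
      rintro _ ⟨φ, hφ, rfl⟩
      have h2 := h1 y hy φ hφ
      refine (key φ _).2 ?_
      rwa [Function.comp_assoc, e.symm_comp_self, Function.comp_id]
  exact ⟨y ∘ e, fun φ hφ => (key φ y).1 (hy _ ⟨φ, hφ, rfl⟩)⟩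

end Types

end MLPairs

namespace MLPairs

namespace PairLanguage

/-! ### Relativization and the two components of a pair -/

section Reducts

variable {S : PairLanguage.{u, v}} {M : Type w} [S.L2.Structure M]

instance isExpansionOn_βTo2 : S.βTo2.IsExpansionOn M := LHom.isExpansionOn_reduct _ _

instance isExpansionOn_αTo2 : S.αTo2.IsExpansionOn M := LHom.isExpansionOn_reduct _ _

theorem realize_βTo2 {γ : Type*} {φ : S.Lβ.Formula γ} {x : γ → M} :
    (S.βTo2.onFormula φ).Realize x ↔ φ.Realize x :=
  LHom.realize_onFormula _ _

theorem realize_predA {γ : Type*} {t : S.L2.Term γ} {x : γ → M} :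
    (S.predA.formula₁ t).Realize x ↔ t.realize x ∈ S.setA M :=
  Formula.realize_rel₁

theorem realize_allInA {γ : Type*} {k : ℕ} {e : Fin k → γ} {x : γ → M} :
    (allInA S.predA e).Realize x ↔ ∀ i, x (e i) ∈ S.setA M := by
  simp only [allInA, Formula.realize_iInf, realize_predA, Term.realize_var]

theorem realize_αTo2_term (h : M ⊨ S.closureAxioms) {γ : Type*} (t : S.Lα.Term γ)
    (x : γ → S.alphaPart M h) :
    (S.αTo2.onTerm t).realize (fun i => (x i : M)) = (t.realize x : S.alphaPart M h) := by
  rw [LHom.realize_onTerm]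
  exact HomClass.realize_term (S.alphaPart M h).subtype

theorem realize_relativizeBdd (h : M ⊨ S.closureAxioms) {γ : Type w'} {n : ℕ}
    (φ : S.Lα.BoundedFormula γ n) (x : γ → S.alphaPart M h) (xs : Fin n → S.alphaPart M h) :
    (S.relativizeBdd φ).Realize (fun i => (x i : M)) (fun i => (xs i : M)) ↔ φ.Realize x xs := by
  have key : ∀ {n : ℕ} (xs : Fin n → S.alphaPart M h),
      Sum.elim (fun i => (x i : M)) (fun i => (xs i : M)) =
        fun i => ((Sum.elim x xs i : S.alphaPart M h) : M) := fun xs => by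
    funext i
    cases i <;> rfl
  induction φ with
  | falsum => exact Iff.rfl
  | equal t₁ t₂ =>
    simp only [relativizeBdd, BoundedFormula.Realize, key, realize_αTo2_term, Subtype.coe_inj]
  | rel R ts =>
    simp only [relativizeBdd, BoundedFormula.Realize, key, realize_αTo2_term]
    rfl
  | imp φ ψ ih₁ ih₂ => simp only [relativizeBdd, BoundedFormula.realize_imp, ih₁, ih₂]
  | all φ ih =>
    simp only [relativizeBdd, BoundedFormula.realize_all, BoundedFormula.realize_imp,
      BoundedFormula.realize_rel₁, Term.realize_var, Sum.elim_inr, Fin.snoc_last]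
    have h1 : ∀ a : S.alphaPart M h, (Fin.snoc (fun i => (xs i : M)) (a : M) : Fin _ → M) =
        fun i => ((Fin.snoc xs a : Fin _ → S.alphaPart M h) i : M) := fun a => by
      funext i
      refine Fin.lastCases ?_ (fun i => ?_) i <;> simp
    constructor
    · intro h2 a
      have h3 := h2 a a.2
      rw [h1] at h3
      exact (ih _).1 h3
    · intro h2 a ha
      have h3 := h1 ⟨a, ha⟩
      dsimp only at h3
      rw [h3]
      exact (ih _).2 (h2 ⟨a, ha⟩)

theorem realize_relativize (h : M ⊨ S.closureAxioms) {γ : Type w'}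
    (φ : S.Lα.Formula γ) (x : γ → S.alphaPart M h) :
    (S.relativize φ).Realize (fun i => (x i : M)) ↔ φ.Realize x := by
  rw [Formula.Realize, Formula.Realize, ← realize_relativizeBdd h]
  exact iff_of_eq (congrArg _ (Subsingleton.elim _ _))

theorem realize_relativize_mk (h : M ⊨ S.closureAxioms) {γ : Type w'}
    (φ : S.Lα.Formula γ) {x : γ → M} (hx : ∀ i, x i ∈ S.setA M) :
    (S.relativize φ).Realize x ↔ φ.Realize (fun i => (⟨x i, hx i⟩ : S.alphaPart M h)) :=
  realize_relativize h φ fun i => ⟨x i, hx i⟩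

theorem coe_realize_term_common (h : M ⊨ S.closureAxioms) {γ : Type*} (t : S.common.Term γ)
    (x : γ → S.alphaPart M h) :
    (((S.commonToα.onTerm t).realize x : S.alphaPart M h) : M) =
      (S.commonToβ.onTerm t).realize fun i => (x i : M) := by
  induction t with
  | var => rfl
  | func f ts ih =>
    have : (fun i => (((S.commonToα.onTerm (ts i)).realize x : S.alphaPart M h) : M)) =
        fun i => (S.commonToβ.onTerm (ts i)).realize fun i => (x i : M) := funext ih
    simp only [LHom.onTerm, Term.realize, ← this]
    rfl

/-- Quantifier-free formulas of the common language have the same meaning in both structures of a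
pair. -/
theorem realize_common_of_isQF (h : M ⊨ S.closureAxioms) {γ : Type*} {n : ℕ}
    {φ : S.common.BoundedFormula γ n} (hφ : φ.IsQF) (x : γ → S.alphaPart M h)
    (xs : Fin n → S.alphaPart M h) :
    (S.commonToα.onBoundedFormula φ).Realize x xs ↔
      (S.commonToβ.onBoundedFormula φ).Realize (fun i => (x i : M)) (fun i => (xs i : M)) := by
  have key : Sum.elim (fun i => (x i : M)) (fun i => (xs i : M)) =
      fun i => ((Sum.elim x xs i : S.alphaPart M h) : M) := by
    funext i
    cases i <;> rfl
  induction hφ with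
  | falsum => exact Iff.rfl
  | of_isAtomic hφ =>
    cases hφ with
    | equal t₁ t₂ =>
      simp only [Term.bdEqual, LHom.onBoundedFormula, BoundedFormula.Realize, key,
        ← coe_realize_term_common, Subtype.coe_inj]
    | rel R ts =>
      simp only [Relations.boundedFormula, LHom.onBoundedFormula, BoundedFormula.Realize, key,
        Function.comp_apply, ← coe_realize_term_common]
      rfl
  | imp _ _ ih₁ ih₂ =>
    simp only [LHom.onBoundedFormula, BoundedFormula.realize_imp, ih₁, ih₂]

variable {Tα : S.Lα.Theory} {Tβ : S.Lβ.Theory}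

theorem model_β (h : M ⊨ S.T2 Tα Tβ) : M ⊨ Tβ :=
  (LHom.onTheory_model S.βTo2 Tβ).1 (h.mono fun _ hσ => Or.inl (Or.inl (Or.inl hσ)))

theorem model_T2_closureAxioms (h : M ⊨ S.T2 Tα Tβ) : M ⊨ S.closureAxioms :=
  h.mono fun _ hσ => Or.inl (Or.inr hσ)

theorem realize_alphaPart_of_models (h : M ⊨ S.T2 Tα Tβ) {σ : S.Lα.Sentence} (hσ : Tα ⊨ᵇ σ) :
    S.alphaPart M (model_T2_closureAxioms h) ⊨ σ := by
  have h1 := h.realize_of_mem (S.relativize σ) (Or.inl (Or.inl (Or.inr ⟨σ, hσ, rfl⟩)))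
  refine (realize_relativize (model_T2_closureAxioms h) σ default).1 ?_
  convert h1 using 1
  exact iff_of_eq (congrArg _ (Subsingleton.elim _ _))

theorem model_α (h : M ⊨ S.T2 Tα Tβ) : S.alphaPart M (model_T2_closureAxioms h) ⊨ Tα :=
  ⟨fun _ hσ => realize_alphaPart_of_models h (Theory.models_sentence_of_mem hσ)⟩

/-- Models are nonempty, so `T_α` proves that something exists, and the relativization of this
sentence is an axiom of `T²`. -/
theorem nonempty_alphaPart (h : M ⊨ S.T2 Tα Tβ) :
    Nonempty (S.alphaPart M (model_T2_closureAxioms h)) := by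
  have h1 : Tα ⊨ᵇ ((⊤ : S.Lα.BoundedFormula Empty 1).ex : S.Lα.Sentence) := fun N v xs => by
    rw [BoundedFormula.realize_ex]
    exact ⟨Classical.arbitrary N, BoundedFormula.realize_top.2 trivial⟩
  have h2 := realize_alphaPart_of_models h h1
  rw [Sentence.Realize, Formula.Realize, BoundedFormula.realize_ex] at h2
  exact h2.nonempty

theorem mem_setA_of_relMap (h : M ⊨ S.T2 Tα Tβ) {n : ℕ} {R : S.alphaOnly n} {x : Fin n → M}
    (hx : Structure.RelMap (L := S.L2) (Sum.inr (ExtraRel.ofAlpha R)) x) (i : Fin n) :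
    x i ∈ S.setA M := by
  have h1 := h.realize_of_mem _ (Or.inr ⟨n, R, rfl⟩)
  rw [Sentence.Realize, Formula.realize_iAlls] at h1
  have h2 := h1 x
  rw [Formula.realize_imp, realize_allInA] at h2
  exact h2 hx i

/-- All symbols added to `L_β` are relational. -/
theorem exists_term_β {γ : Type*} (t : S.L2.Term γ) :
    ∃ t' : S.Lβ.Term γ, S.βTo2.onTerm t' = t := by
  induction t with
  | var i => exact ⟨Term.var i, rfl⟩
  | func f ts ih =>
    choose ts' hts' using ih
    rcases f with f | f
    · exact ⟨Term.func f ts', by simp only [LHom.onTerm, hts']; rfl⟩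
    · exact f.elim

end Reducts

end PairLanguage

end MLPairs

namespace MLPairs

/-! ### Partial isomorphisms and extension by density -/

section Types

variable {L : FirstOrder.Language.{u, v}} {ι : Type*} {M N : Type*} [L.Structure M] [L.Structure N]
  {c : ι → M} {d : ι → N}

theorem sameType_of_imp (h : ∀ φ : L.Formula ι, φ.Realize c → φ.Realize d) : SameType L c d :=
  fun φ => ⟨h φ, fun hd => by
    by_contra hc
    exact h φ.not hc hd⟩

/-- A realization of a transferred type has the same type as the original element. -/
theorem SameType.of_transferType {D : Set N} {c' : D → M} {b : M} {a : N} (f : ι → D)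
    (hd : ∀ i, (f i : N) = d i) (hc : ∀ i, c' (f i) = c i)
    (h : ∀ φ ∈ transferType (L := L) c' b, φ.Realize (Sum.elim (fun x : D => (x : N)) fun _ => a)) :
    SameType L (Sum.elim c fun _ : Unit => b) (Sum.elim d fun _ : Unit => a) := by
  obtain rfl : (fun i => (f i : N)) = d := funext hd
  obtain rfl : c' ∘ f = c := funext hc
  refine sameType_of_imp fun φ hφ => ?_
  have h1 := h (φ.relabel (Sum.map f fun _ => 0)) (by
    rw [transferType, Set.mem_ofPred_eq, Formula.realize_relabel, Sum.elim_comp_map]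
    exact hφ)
  rw [Formula.realize_relabel, Sum.elim_comp_map] at h1
  exact h1

end Types

theorem range_sumElim_unit {ι M : Type*} (c : ι → M) (b : M) :
    Set.range (Sum.elim c fun _ : Unit => b) = insert b (Set.range c) := by
  rw [Set.Sum.elim_range, Set.range_const, Set.union_singleton]

namespace PairLanguage

variable {S : PairLanguage.{u, v}}

theorem realize_relativize_relabel {M : Type w} [S.L2.Structure M] (h : M ⊨ S.closureAxioms)
    {γ δ : Type*} (ψ : S.Lα.Formula γ) (g : γ → δ) {x : δ → M} (hx : ∀ i, x i ∈ S.setA M) :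
    (S.relativize (ψ.relabel g)).Realize x ↔ (S.relativize ψ).Realize (x ∘ g) := by
  rw [realize_relativize_mk h _ hx, Formula.realize_relabel]
  exact (realize_relativize_mk h ψ fun i => hx (g i)).symm

theorem relativize_inf {γ : Type*} (ψ χ : S.Lα.Formula γ) :
    S.relativize (ψ ⊓ χ) = S.relativize ψ ⊓ S.relativize χ := rfl

theorem isPregeometry_acl {Tα : S.Lα.Theory} {Tβ : S.Lβ.Theory} (hβ : IsGeometric Tβ)
    {M : Type (max u v)} [S.L2.Structure M] [Nonempty M] (h : M ⊨ S.T2 Tα Tβ) :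
    IsPregeometry (acl S.Lβ (M := M)) :=
  have := model_β h
  hβ.pregeometry (Theory.ModelType.of Tβ M)

variable (S) in
/-- The tuples `c` and `d` correspond to each other under a partial isomorphism of pairs between
free sets. -/
structure IsPartialIso {ι : Type} {M N : Type w} [S.L2.Structure M] [S.L2.Structure N]
    (c : ι → M) (d : ι → N) : Prop where
  beta : SameType S.Lβ c d
  mem : ∀ i, c i ∈ S.setA M ↔ d i ∈ S.setA N
  alpha : ∀ (η : Type) (e : η → ι), (∀ j, c (e j) ∈ S.setA M) → ∀ ψ : S.Lα.Formula η,
    (S.relativize ψ).Realize (c ∘ e) ↔ (S.relativize ψ).Realize (d ∘ e)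
  free_left : IsFreeOver (acl S.Lβ) (Set.range c) (S.setA M)
  free_right : IsFreeOver (acl S.Lβ) (Set.range d) (S.setA N)

namespace IsPartialIso

section Basic

variable {ι : Type} {M N : Type w} [S.L2.Structure M] [S.L2.Structure N] {c : ι → M} {d : ι → N}

theorem symm (h : S.IsPartialIso c d) : S.IsPartialIso d c where
  beta := h.beta.symm
  mem i := (h.mem i).symm
  alpha η e he ψ := (h.alpha η e (fun j => (h.mem _).2 (he j)) ψ).symm
  free_left := h.free_right
  free_right := h.free_left

/-- For the `L_α`-part one implication suffices because of negations. A tuple of indices with values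
in `A` uses only old indices in `A` and, if `b ∈ A`, the new one. -/
theorem extend (hM : M ⊨ S.closureAxioms) (hN : N ⊨ S.closureAxioms) (h : S.IsPartialIso c d)
    {b : M} {a : N}
    (hβ : SameType S.Lβ (Sum.elim c fun _ : Unit => b) (Sum.elim d fun _ : Unit => a))
    (hmem : b ∈ S.setA M ↔ a ∈ S.setA N)
    (hα : b ∈ S.setA M → ∀ ψ : S.Lα.Formula ({i // c i ∈ S.setA M} ⊕ Unit),
      (S.relativize ψ).Realize (Sum.elim (fun i => c i) fun _ => b) →
        (S.relativize ψ).Realize (Sum.elim (fun i => d i) fun _ => a))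
    (hfree : IsFreeOver (acl S.Lβ) (insert b (Set.range c)) (S.setA M))
    (hfree' : IsFreeOver (acl S.Lβ) (insert a (Set.range d)) (S.setA N)) :
    S.IsPartialIso (Sum.elim c fun _ : Unit => b) (Sum.elim d fun _ : Unit => a) where
  beta := hβ
  mem := by
    rintro (i | i)
    · exact h.mem i
    · exact hmem
  alpha η e he ψ := by
    by_cases hb : b ∈ S.setA M
    · have hx : ∀ i : {i // c i ∈ S.setA M} ⊕ Unit,
          Sum.elim (fun i : {i // c i ∈ S.setA M} => c i) (fun _ => b) i ∈ S.setA M := by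
        rintro (i | i)
        · exact i.2
        · exact hb
      have hy : ∀ i : {i // c i ∈ S.setA M} ⊕ Unit,
          Sum.elim (fun i : {i // c i ∈ S.setA M} => d i) (fun _ => a) i ∈ S.setA N := by
        rintro (i | i)
        · exact (h.mem _).1 i.2
        · exact hmem.1 hb
      have hg : ∀ j, ∃ i : {i // c i ∈ S.setA M} ⊕ Unit, e j = Sum.map Subtype.val id i := by
        intro j
        have h1 := he j
        rcases hj : e j with i | i
        · rw [hj] at h1
          exact ⟨Sum.inl ⟨i, h1⟩, rfl⟩
        · exact ⟨Sum.inr i, rfl⟩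
      choose g hg using hg
      have h1 : ∀ ψ : S.Lα.Formula ({i // c i ∈ S.setA M} ⊕ Unit),
          (S.relativize ψ).Realize (Sum.elim (fun i => c i) fun _ => b) ↔
            (S.relativize ψ).Realize (Sum.elim (fun i => d i) fun _ => a) := fun ψ =>
        ⟨hα hb ψ, fun hd => by
          by_contra hc
          exact hα hb ψ.not hc hd⟩
      have h2 := h1 (ψ.relabel g)
      rw [realize_relativize_relabel hM _ _ hx, realize_relativize_relabel hN _ _ hy] at h2
      have h3 : e = Sum.map Subtype.val id ∘ g := funext hg
      rw [h3, ← Function.comp_assoc, ← Function.comp_assoc, Sum.elim_comp_map, Sum.elim_comp_map]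
      exact h2
    · have hg : ∀ j, ∃ i, e j = Sum.inl i := by
        intro j
        have h1 := he j
        rcases hj : e j with i | i
        · exact ⟨i, rfl⟩
        · rw [hj] at h1
          exact absurd h1 hb
      choose g hg using hg
      obtain rfl : e = Sum.inl ∘ g := funext hg
      exact h.alpha η g he ψ
  free_left := by rwa [range_sumElim_unit]
  free_right := by rwa [range_sumElim_unit]

end Basic

section MLTheory

variable {Tα : S.Lα.Theory} {Tβ : S.Lβ.Theory} {T : S.L2.Theory}
  {M N : Theory.ModelType.{u, v, max u v} T} {ι : Type} {c : ι → M} {d : ι → N}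
  {κ : Cardinal.{max u v}}

theorem sameType_alphaPart (hM : M ⊨ S.closureAxioms) (hN : N ⊨ S.closureAxioms)
    (h : S.IsPartialIso c d) {η : Type} (e : η → ι) (he : ∀ j, c (e j) ∈ S.setA M) :
    SameType S.Lα (fun j => (⟨c (e j), he j⟩ : S.alphaPart M hM))
      (fun j => (⟨d (e j), (h.mem _).1 (he j)⟩ : S.alphaPart N hN)) := fun ψ => by
  rw [← realize_relativize hM, ← realize_relativize hN]
  exact h.alpha η e he ψ

variable [Finite ι]

/-- Density is applied to the transferred `L_β`-type and `L_α`-type of `b`. -/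
theorem exists_extend_of_mem_of_notMem_acl (hβ : IsGeometric Tβ) (hT : IsMLTheory Tα Tβ T)
    (hκ : max ℵ₀ S.L2.card < κ) (hN : IsSaturated S.L2 κ N) (h : S.IsPartialIso c d) {b : M}
    (hbA : b ∈ S.setA M) (hb : b ∉ acl S.Lβ (Set.range c)) :
    ∃ a : N, S.IsPartialIso (Sum.elim c fun _ : Unit => b) (Sum.elim d fun _ : Unit => a) := by
  have hM2 : M ⊨ S.T2 Tα Tβ := M.is_model.mono hT.extends_T2
  have hN2 : N ⊨ S.T2 Tα Tβ := N.is_model.mono hT.extends_T2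
  have hMc := model_T2_closureAxioms hM2
  have hNc := model_T2_closureAxioms hN2
  have hden := hT.density κ hκ N hN (Set.range d)
    ((Cardinal.lt_aleph0_of_finite _).trans ((le_max_left _ _).trans_lt hκ))
  -- Density speaks of parameter sets, so an index is chosen for each element of the range of `d`.
  let r : Set.range d → ι := Set.rangeSplitting d
  have hr : ∀ x, d (r x) = x := Set.apply_rangeSplitting d
  have hrA : ∀ x : {a : S.alphaPart N hNc | (a : N) ∈ Set.range d},
      c (r ⟨x.1.1, x.2⟩) ∈ S.setA M := fun x => by
    rw [h.mem, hr]
    exact x.1.2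
  let cA : {a : S.alphaPart N hNc | (a : N) ∈ Set.range d} → S.alphaPart M hMc :=
    fun x => ⟨c (r ⟨x.1.1, x.2⟩), hrA x⟩
  have hq : SameType S.Lβ (c ∘ r) (fun x : Set.range d => (x : N)) := by
    have h1 := h.beta.comp r
    rwa [show d ∘ r = fun x : Set.range d => (x : N) from funext hr] at h1
  have hp : SameType S.Lα cA (fun x => (x : S.alphaPart N hNc)) := by
    have h1 := (h.sameType_alphaPart hMc hNc (η := {i // c i ∈ S.setA M}) Subtype.val
      fun j => j.2).comp (fun x : {a : S.alphaPart N hNc | (a : N) ∈ Set.range d} =>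
        (⟨r ⟨x.1.1, x.2⟩, hrA x⟩ : {i // c i ∈ S.setA M}))
    have h2 : ((fun j : {i // c i ∈ S.setA M} =>
        (⟨d j, (h.mem _).1 j.2⟩ : S.alphaPart N hNc)) ∘
          fun x : {a : S.alphaPart N hNc | (a : N) ∈ Set.range d} => ⟨r ⟨x.1.1, x.2⟩, hrA x⟩) =
        fun x : {a : S.alphaPart N hNc | (a : N) ∈ Set.range d} => (x : S.alphaPart N hNc) :=
      funext fun x => Subtype.ext (hr ⟨x.1.1, x.2⟩)
    rwa [h2] at h1
  obtain ⟨a, haA, hap, haq⟩ := hden (transferType (c ∘ r) b) (transferType cA ⟨b, hbA⟩)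
    (isTypeOver_transferType hq b)
    (nonAlgebraic_transferType hq fun hcl => hb ((isPregeometry_acl hβ hM2).mono _ _
      (Set.range_comp_subset_range r c) hcl))
    (isTypeOver_transferType hp _) <| by
      -- The types are compatible because both come from `b ∈ A`, and quantifier-free common
      -- formulas mean the same in the two components.
      intro χ hχ hmem
      rw [transferType, Set.mem_ofPred_eq, Formula.realize_relabel, Sum.elim_comp_map]
      have h1 := (realize_common_of_isQF hMc hχ _ _).1 hmem
      have h2 : (fun i => ((Sum.elim cA (fun _ : Fin 1 => ⟨b, hbA⟩) i : S.alphaPart M hMc) : M)) =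
          Sum.elim ((c ∘ r) ∘ fun x : {a : S.alphaPart N hNc | (a : N) ∈ Set.range d} =>
            (⟨x.1.1, x.2⟩ : Set.range d)) ((fun _ : Fin 1 => b) ∘ id) := by
        funext x
        rcases x with x | x <;> rfl
      rw [h2] at h1
      rw [Formula.Realize]
      convert h1 using 1
      rfl
  refine ⟨a, h.extend hMc hNc ?_ (iff_of_true hbA haA) (fun _ ψ hψ => ?_) ?_ ?_⟩
  · refine SameType.of_transferType (Set.rangeFactorization d) (fun _ => rfl) (fun i => ?_) haq
    -- The chosen index may differ from `i`, but equal components of `d` correspond to equal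
    -- components of `c`.
    exact h.beta.eq_iff.2 (hr _)
  · have hx : ∀ i : {i // c i ∈ S.setA M} ⊕ Unit,
        Sum.elim (fun i : {i // c i ∈ S.setA M} => c i) (fun _ => b) i ∈ S.setA M := by
      rintro (i | i)
      · exact i.2
      · exact hbA
    have hy : ∀ i : {i // c i ∈ S.setA M} ⊕ Unit,
        Sum.elim (fun i : {i // c i ∈ S.setA M} => d i) (fun _ => a) i ∈ S.setA N := by
      rintro (i | i)
      · exact (h.mem _).1 i.2
      · exact haA
    have h1 : SameType S.Lα
        (Sum.elim (fun i : {i // c i ∈ S.setA M} => (⟨c i, i.2⟩ : S.alphaPart M hMc))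
          fun _ : Unit => ⟨b, hbA⟩)
        (Sum.elim (fun i : {i // c i ∈ S.setA M} =>
          (⟨d i, (h.mem _).1 i.2⟩ : S.alphaPart N hNc)) fun _ : Unit => ⟨a, haA⟩) := by
      refine SameType.of_transferType (c' := cA)
        (fun i => ⟨⟨d i, (h.mem _).1 i.2⟩, i, rfl⟩) (fun _ => rfl) (fun i => ?_) fun φ hφ => ?_
      · exact Subtype.ext (h.beta.eq_iff.2 (hr _))
      · have h2 := hap φ hφ
        rw [← realize_relativize hNc]
        convert h2 using 1
        funext x
        rcases x with x | x <;> rfl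
    rw [realize_relativize_mk hNc _ hy]
    rw [realize_relativize_mk hMc _ hx] at hψ
    convert (h1 ψ).1 ?_ using 1
    · funext x
      rcases x with x | x <;> rfl
    · convert hψ using 1
      funext x
      rcases x with x | x <;> rfl
  · exact h.free_left.insert_of_mem (isPregeometry_acl hβ hM2) (Or.inl hbA)
  · exact h.free_right.insert_of_mem (isPregeometry_acl hβ hN2) (Or.inl haA)

end MLTheory

end IsPartialIso

end PairLanguage

end MLPairs

namespace MLPairs

namespace PairLanguage

variable {S : PairLanguage.{u, v}}

/-! ### Mordell-Lang challenges and the remaining extension steps -/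

namespace IsPartialIso

section Basic

variable {ι : Type} {M N : Type w} [S.L2.Structure M] [S.L2.Structure N] {c : ι → M} {d : ι → N}

theorem refl_left (h : S.IsPartialIso c d) : S.IsPartialIso c c where
  beta _ := Iff.rfl
  mem _ := Iff.rfl
  alpha _ _ _ _ := Iff.rfl
  free_left := h.free_left
  free_right := h.free_left

theorem comp_equiv (h : S.IsPartialIso c d) {η : Type} (e : η ≃ ι) :
    S.IsPartialIso (c ∘ e) (d ∘ e) where
  beta := h.beta.comp e
  mem i := h.mem (e i)
  alpha η' f hf ψ := h.alpha η' (e ∘ f) hf ψ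
  free_left := by
    rw [e.surjective.range_comp]
    exact h.free_left
  free_right := by
    rw [e.surjective.range_comp]
    exact h.free_right

end Basic

variable {Tα : S.Lα.Theory} {Tβ : S.Lβ.Theory} {T : S.L2.Theory}

/-- The challenge given by the types of a tuple. -/
noncomputable def challenge {M : Type (max u v)} [S.L2.Structure M] [Nonempty M]
    (hM : M ⊨ S.T2 Tα Tβ) {n : ℕ} (x : Fin n → M) (φ : S.Lβ.Formula (Fin n ⊕ Unit))
    (ψ : S.Lα.Formula ({j | x j ∈ S.setA M} ⊕ Unit)) (m : ℕ) : Challenge Tα Tβ where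
  n := n
  idx := {j | x j ∈ S.setA M}
  p :=
    have := model_α hM
    have := nonempty_alphaPart hM
    Tα.typeOf fun j : {j | x j ∈ S.setA M} =>
      (⟨x j, j.2⟩ : S.alphaPart M (model_T2_closureAxioms hM))
  q :=
    have := model_β hM
    Tβ.typeOf x
  φ := fewer m φ
  ψ := ψ
  -- The bound inside `fewer m φ` gives finiteness for every tuple, whatever its type.
  finite_of_realizes _ c _ := finite_fewer m φ c

theorem isContender {M N : Type (max u v)} [S.L2.Structure M] [Nonempty M] [S.L2.Structure N]
    [Nonempty N] (hβ : IsGeometric Tβ) (hM : M ⊨ S.T2 Tα Tβ) (hN : N ⊨ S.T2 Tα Tβ) {n : ℕ}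
    {x : Fin n → M} {y : Fin n → N} (h : S.IsPartialIso x y) (φ : S.Lβ.Formula (Fin n ⊕ Unit))
    (ψ : S.Lα.Formula ({j | x j ∈ S.setA M} ⊕ Unit)) (m : ℕ) :
    (challenge hM x φ ψ m).IsContender N y where
  mem_iff i := (h.mem i).symm
  realizes_q χ hχ := by
    have := model_β hM
    exact (h.beta χ).1 (Theory.CompleteType.formula_mem_typeOf.1 hχ)
  realizes_p θ hθ := by
    have := model_α hM
    have := nonempty_alphaPart hM
    have h1 := Theory.CompleteType.formula_mem_typeOf.1 hθ
    exact (h.alpha _ Subtype.val (fun j => j.2) θ).1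
      ((realize_relativize (model_T2_closureAxioms hM) θ
        fun j : {j | x j ∈ S.setA M} => ⟨x j, j.2⟩).2 h1)
  indep := by
    have h1 : y '' {j | x j ∈ S.setA M} = Set.range y ∩ S.setA N := by
      ext a
      constructor
      · rintro ⟨j, hj, rfl⟩
        exact ⟨⟨j, rfl⟩, (h.mem j).1 hj⟩
      · rintro ⟨⟨j, rfl⟩, hj⟩
        exact ⟨j, (h.mem j).2 hj, rfl⟩
    change IndependentOver _ (Set.range y) _ (y '' {j | x j ∈ S.setA M})
    rw [h1]
    exact h.free_right.independentOver (isPregeometry_acl hβ hN)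

section MLTheory

variable {M N : Theory.ModelType.{u, v, max u v} T} {ι : Type} [Finite ι] {c : ι → M} {d : ι → N}
  {κ : Cardinal.{max u v}}

/-- The tuple `c` with `b` solves the challenge given by its own types, and `d` is a contender for
it, so the Mordell-Lang condition gives `a`. The reindexing by `Fin n` only adapts to the form of
challenges. -/
theorem exists_of_mem_acl (hβ : IsGeometric Tβ) (hT : IsMLTheory Tα Tβ T) (h : S.IsPartialIso c d)
    {b : M} (hbA : b ∈ S.setA M) {φ : S.Lβ.Formula (ι ⊕ Unit)}
    {ψ : S.Lα.Formula ({i // c i ∈ S.setA M} ⊕ Unit)} {m : ℕ}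
    (hφ : (fewer m φ).Realize (Sum.elim c fun _ => b))
    (hψ : (S.relativize ψ).Realize (Sum.elim (fun i => c i) fun _ => b)) :
    ∃ a ∈ S.setA N, φ.Realize (Sum.elim d fun _ => a) ∧
      (S.relativize ψ).Realize (Sum.elim (fun i : {i // c i ∈ S.setA M} => d i) fun _ => a) := by
  have hM2 : M ⊨ S.T2 Tα Tβ := M.is_model.mono hT.extends_T2
  have hN2 : N ⊨ S.T2 Tα Tβ := N.is_model.mono hT.extends_T2
  obtain ⟨n, ⟨e⟩⟩ := Finite.exists_equiv_fin ι
  have h' := h.comp_equiv e.symm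
  let g : {i // c i ∈ S.setA M} → {j | (c ∘ e.symm) j ∈ S.setA M} := fun i =>
    ⟨e i.1, by
      have h1 := i.2
      rwa [← e.symm_apply_apply i.1] at h1⟩
  have hφ' : ∀ {K : Type _} [S.Lβ.Structure K] (x : ι → K) (y : K),
      (fewer m (φ.relabel (Sum.map e id))).Realize (Sum.elim (x ∘ e.symm) fun _ => y) ↔
        (fewer m φ).Realize (Sum.elim x fun _ => y) := by
    intro K _ x y
    simp only [realize_fewer, realize_atLeast, Formula.realize_relabel, Sum.elim_comp_map,
      Function.comp_assoc, e.symm_comp_self, Function.comp_id]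
  have hxM : ∀ i, Sum.elim (fun j : {j | (c ∘ e.symm) j ∈ S.setA M} => (c ∘ e.symm) j)
      (fun _ : Unit => b) i ∈ S.setA M := by
    rintro (i | i)
    · exact i.2
    · exact hbA
  have hg : ∀ {K : Type _} (x : ι → K) (y : K),
      Sum.elim (fun j : {j | (c ∘ e.symm) j ∈ S.setA M} => (x ∘ e.symm) j) (fun _ : Unit => y) ∘
        Sum.map g id = Sum.elim (fun i : {i // c i ∈ S.setA M} => x i) fun _ => y := by
    intro K x y
    funext i
    rcases i with i | i
    · simp [g]
    · rfl
  obtain ⟨a, ha⟩ := hT.mordellLang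
    (challenge hM2 (c ∘ e.symm) (φ.relabel (Sum.map e id)) (ψ.relabel (Sum.map g id)) m)
    ⟨M, c ∘ e.symm, b, ⟨h'.refl_left.isContender hβ hM2 hM2 _ _ _, hbA, (hφ' c b).2 hφ, by
      refine (realize_relativize_relabel (model_T2_closureAxioms hM2) _ _ hxM).2 ?_
      rw [hg]
      exact hψ⟩⟩ N (d ∘ e.symm) (h'.isContender hβ hM2 hN2 _ _ _)
  refine ⟨a, ha.mem, (realize_fewer.1 ((hφ' d a).1 ha.realizes_φ)).1, ?_⟩
  have hxN : ∀ i, Sum.elim (fun j : {j | (c ∘ e.symm) j ∈ S.setA M} => (d ∘ e.symm) j)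
      (fun _ : Unit => a) i ∈ S.setA N := by
    rintro (i | i)
    · exact (h.mem _).1 i.2
    · exact ha.mem
  have h1 := (realize_relativize_relabel (model_T2_closureAxioms hN2) _ _ hxN).1 ha.realizes_ψ
  rwa [hg] at h1

/-- The Mordell-Lang condition handles one pair of formulas at a time; these pairs are closed under
conjunction, so saturation realizes them together. -/
theorem exists_extend_of_mem_of_mem_acl (hβ : IsGeometric Tβ) (hT : IsMLTheory Tα Tβ T)
    (hκ : ℵ₀ ≤ κ) (hN : IsPartialSaturated S.L2 κ N) (h : S.IsPartialIso c d) {b : M}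
    (hbA : b ∈ S.setA M) (hb : b ∈ acl S.Lβ (Set.range c)) :
    ∃ a : N, S.IsPartialIso (Sum.elim c fun _ : Unit => b) (Sum.elim d fun _ : Unit => a) := by
  have hM2 : M ⊨ S.T2 Tα Tβ := M.is_model.mono hT.extends_T2
  have hN2 : N ⊨ S.T2 Tα Tβ := N.is_model.mono hT.extends_T2
  obtain ⟨m, φ₀, hφ₀⟩ := mem_acl_range_iff.1 hb
  let F : S.Lβ.Formula (ι ⊕ Unit) → S.Lα.Formula ({i // c i ∈ S.setA M} ⊕ Unit) →
      S.L2.Formula (ι ⊕ Unit) := fun φ ψ =>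
    S.predA.formula₁ (Term.var (Sum.inr ())) ⊓
      (S.βTo2.onFormula φ ⊓ (S.relativize ψ).relabel (Sum.map Subtype.val id))
  have hF : ∀ φ ψ (y : Unit → N), (F φ ψ).Realize (Sum.elim d y) ↔ y () ∈ S.setA N ∧
      φ.Realize (Sum.elim d fun _ => y ()) ∧
        (S.relativize ψ).Realize (Sum.elim (fun i : {i // c i ∈ S.setA M} => d i)
          fun _ => y ()) := by
    intro φ ψ y
    simp only [F, Formula.realize_inf, realize_predA, realize_βTo2, Formula.realize_relabel,
      Sum.elim_comp_map, Term.realize_var, Sum.elim_inr]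
    rfl
  obtain ⟨y, hy⟩ := hN.exists_realize hκ d
    {γ | ∃ φ ψ, φ.Realize (Sum.elim c fun _ => b) ∧
      (S.relativize ψ).Realize (Sum.elim (fun i : {i // c i ∈ S.setA M} => c i) fun _ => b) ∧
        γ = F φ ψ}
    ⟨F ⊤ ⊤, ⊤, ⊤, Formula.realize_top.2 trivial, id, rfl⟩ (by
      rintro _ ⟨φ, ψ, hφ, hψ, rfl⟩ _ ⟨φ', ψ', hφ', hψ', rfl⟩
      refine ⟨_, ⟨φ ⊓ φ', ψ ⊓ ψ', Formula.realize_inf.2 ⟨hφ, hφ'⟩, ?_, rfl⟩, fun y => ?_⟩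
      · rw [relativize_inf]
        exact Formula.realize_inf.2 ⟨hψ, hψ'⟩
      · rw [hF, hF, hF, relativize_inf, Formula.realize_inf, Formula.realize_inf]
        tauto) (by
      rintro _ ⟨φ, ψ, hφ, hψ, rfl⟩
      -- The formula `φ` alone need not be algebraic; the conjunct `fewer m φ₀` leaves it fewer than
      -- `m` solutions.
      obtain ⟨a, haA, ha⟩ := h.exists_of_mem_acl hβ hT hbA (φ := φ ⊓ fewer m φ₀) (m := m) (by
        refine realize_fewer.2 ⟨Formula.realize_inf.2 ⟨hφ, hφ₀⟩, fun hm => ?_⟩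
        refine (realize_fewer.1 hφ₀).2 ?_
        rw [realize_atLeast] at hm ⊢
        obtain ⟨f, hf, hf'⟩ := hm
        exact ⟨f, hf, fun i => (realize_fewer.1 (Formula.realize_inf.1 (hf' i)).2).1⟩) hψ
      exact ⟨fun _ => a, (hF _ _ _).2 ⟨haA, (Formula.realize_inf.1 ha.1).1, ha.2⟩⟩)
  have hyβ : ∀ φ : S.Lβ.Formula (ι ⊕ Unit), φ.Realize (Sum.elim c fun _ => b) →
      φ.Realize (Sum.elim d fun _ => y ()) := fun φ hφ =>
    ((hF _ _ _).1 (hy _ ⟨φ, ⊤, hφ, id, rfl⟩)).2.1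
  have hyA := ((hF _ _ _).1 (hy _ ⟨⊤, ⊤, Formula.realize_top.2 trivial, id, rfl⟩)).1
  refine ⟨y (), h.extend (model_T2_closureAxioms hM2) (model_T2_closureAxioms hN2)
    (sameType_of_imp hyβ) (iff_of_true hbA hyA) (fun _ ψ hψ => ?_) ?_ ?_⟩
  · exact ((hF _ _ _).1 (hy _ ⟨⊤, ψ, Formula.realize_top.2 trivial, hψ, rfl⟩)).2.2
  · exact h.free_left.insert_of_mem (isPregeometry_acl hβ hM2) (Or.inl hbA)
  · exact h.free_right.insert_of_mem (isPregeometry_acl hβ hN2) (Or.inl hyA)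

theorem exists_extend_of_mem (hβ : IsGeometric Tβ) (hT : IsMLTheory Tα Tβ T)
    (hκ : max ℵ₀ S.L2.card < κ) (hN : IsPartialSaturated S.L2 κ N) (h : S.IsPartialIso c d) {b : M}
    (hbA : b ∈ S.setA M) :
    ∃ a : N, S.IsPartialIso (Sum.elim c fun _ : Unit => b) (Sum.elim d fun _ : Unit => a) := by
  by_cases hb : b ∈ acl S.Lβ (Set.range c)
  · exact h.exists_extend_of_mem_of_mem_acl hβ hT ((le_max_left _ _).trans hκ.le) hN hbA hb
  · exact h.exists_extend_of_mem_of_notMem_acl hβ hT hκ hN.isSaturated hbA hb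

/-- Codensity gives an image that is also generic over `A` and the tuple, so both sides stay free by
enlarging their bases. -/
theorem exists_extend_of_notMem_acl (hβ : IsGeometric Tβ) (hT : IsMLTheory Tα Tβ T)
    (hκ : max ℵ₀ S.L2.card < κ) (hN : IsPartialSaturated S.L2 κ N) (h : S.IsPartialIso c d) {b : M}
    (hb : b ∉ acl S.Lβ (S.setA M ∪ Set.range c)) :
    ∃ a : N, S.IsPartialIso (Sum.elim c fun _ : Unit => b) (Sum.elim d fun _ : Unit => a) := by
  have hM2 : M ⊨ S.T2 Tα Tβ := M.is_model.mono hT.extends_T2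
  have hN2 : N ⊨ S.T2 Tα Tβ := N.is_model.mono hT.extends_T2
  have hclM := isPregeometry_acl hβ hM2
  have hclN := isPregeometry_acl hβ hN2
  let r : Set.range d → ι := Set.rangeSplitting d
  have hr : ∀ x, d (r x) = x := Set.apply_rangeSplitting d
  have hq : SameType S.Lβ (c ∘ r) (fun x : Set.range d => (x : N)) := by
    have h1 := h.beta.comp r
    rwa [show d ∘ r = fun x : Set.range d => (x : N) from funext hr] at h1
  obtain ⟨a, ha, haq⟩ := hT.codensity κ hκ N hN.isSaturated (Set.range d)
    ((Cardinal.lt_aleph0_of_finite _).trans ((le_max_left _ _).trans_lt hκ))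
    (transferType (c ∘ r) b) (isTypeOver_transferType hq b)
    (nonAlgebraic_transferType hq fun hcl => hb (hclM.mono _ _
      ((Set.range_comp_subset_range r c).trans Set.subset_union_right) hcl))
  have hbA : b ∉ S.setA M := fun h1 => hb (hclM.subset_cl _ (Or.inl h1))
  have haA : a ∉ S.setA N := fun h1 => ha (hclN.subset_cl _ (Or.inl h1))
  refine ⟨a, h.extend (model_T2_closureAxioms hM2) (model_T2_closureAxioms hN2)
    (SameType.of_transferType (Set.rangeFactorization d) (fun _ => rfl)
      (fun i => h.beta.eq_iff.2 (hr _)) haq)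
    (iff_of_false hbA haA) (fun h1 => absurd h1 hbA) ?_ ?_⟩
  · exact h.free_left.insert_of_notMem hclM hb
  · exact h.free_right.insert_of_notMem hclN ha

/-- A partial isomorphism can be extended to a finite subset of `A`. -/
theorem exists_extend_finite (hβ : IsGeometric Tβ) (hT : IsMLTheory Tα Tβ T)
    (hκ : max ℵ₀ S.L2.card < κ) (hN : IsPartialSaturated S.L2 κ N) (h : S.IsPartialIso c d)
    {F : Set M} (hF : F.Finite) (hFA : F ⊆ S.setA M) :
    ∃ (ι' : Type) (_ : Finite ι') (e : ι → ι') (c' : ι' → M) (d' : ι' → N),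
      S.IsPartialIso c' d' ∧ c' ∘ e = c ∧ d' ∘ e = d ∧ F ⊆ Set.range c' := by
  induction F, hF using Set.Finite.induction_on with
  | empty => exact ⟨ι, inferInstance, id, c, d, h, rfl, rfl, Set.empty_subset _⟩
  | @insert b F _ _ ih =>
    rw [Set.insert_subset_iff] at hFA
    obtain ⟨ι', _, e, c', d', h', hc, hd, hF'⟩ := ih hFA.2
    obtain ⟨a, ha⟩ := h'.exists_extend_of_mem hβ hT hκ hN hFA.1
    refine ⟨ι' ⊕ Unit, inferInstance, Sum.inl ∘ e, _, _, ha, hc, hd, ?_⟩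
    rw [range_sumElim_unit]
    exact Set.insert_subset_insert hF'

/-- When `b ∉ A`, the only danger is that a realization of the transferred `L_β`-type falls into
`A`. Putting all solutions in `A` of an algebraic formula for `b` into the domain first excludes
this. -/
theorem exists_extend_of_mem_acl (hβ : IsGeometric Tβ) (hT : IsMLTheory Tα Tβ T)
    (hκ : max ℵ₀ S.L2.card < κ) (hM : IsPartialSaturated S.L2 κ M)
    (hN : IsPartialSaturated S.L2 κ N) (h : S.IsPartialIso c d) {b : M}
    (hb : b ∈ acl S.Lβ (Set.range c)) :
    ∃ (ι' : Type) (_ : Finite ι') (e : ι → ι') (c' : ι' → M) (d' : ι' → N),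
      S.IsPartialIso c' d' ∧ c' ∘ e = c ∧ d' ∘ e = d ∧ b ∈ Set.range c' := by
  by_cases hbA : b ∈ S.setA M
  · obtain ⟨ι', h1, e, c', d', h2, h3, h4, h5⟩ :=
      h.exists_extend_finite hβ hT hκ hN (Set.finite_singleton b) (Set.singleton_subset_iff.2 hbA)
    exact ⟨ι', h1, e, c', d', h2, h3, h4, h5 rfl⟩
  have hM2 : M ⊨ S.T2 Tα Tβ := M.is_model.mono hT.extends_T2
  have hN2 : N ⊨ S.T2 Tα Tβ := N.is_model.mono hT.extends_T2
  obtain ⟨m, φ, hφ⟩ := mem_acl_range_iff.1 hb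
  obtain ⟨ι', _, e, c', d', h', rfl, rfl, hF⟩ := h.exists_extend_finite hβ hT hκ hN
    (F := {y | (fewer m φ).Realize (Sum.elim c fun _ => y)} ∩ S.setA M)
    ((finite_fewer m φ c).inter_of_left _) Set.inter_subset_right
  -- A solution in `A` on the right can be pulled back to one on the left, which is already in the
  -- domain. This is where saturation of `M` is used.
  have hE : ∀ a ∈ S.setA N, (fewer m φ).Realize (Sum.elim (d' ∘ e) fun _ => a) →
      a ∈ Set.range d' := by
    intro a haA ha
    obtain ⟨y, hy⟩ := h'.symm.exists_extend_of_mem hβ hT hκ hM haA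
    have hyA : y ∈ S.setA M := (hy.mem (Sum.inr ())).1 haA
    have hyφ : (fewer m φ).Realize (Sum.elim (c' ∘ e) fun _ => y) := by
      have h1 := hy.beta ((fewer m φ).relabel (Sum.map e id))
      rw [Formula.realize_relabel, Formula.realize_relabel, Sum.elim_comp_map,
        Sum.elim_comp_map] at h1
      exact h1.1 ha
    obtain ⟨i, hi⟩ := hF ⟨hyφ, hyA⟩
    exact ⟨i, (hy.beta.eq_iff (i := Sum.inl i) (j := Sum.inr ())).2 hi⟩
  have hb' : b ∈ acl S.Lβ (Set.range c') :=
    (isPregeometry_acl hβ hM2).mono _ _ (Set.range_comp_subset_range e c') hb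
  obtain ⟨y, hy⟩ := hN.exists_realize ((le_max_left _ _).trans hκ.le) d' (η := Unit)
    (S.βTo2.onFormula '' {χ | χ.Realize (Sum.elim c' fun _ => b)})
    ⟨_, ⊤, Formula.realize_top.2 trivial, rfl⟩ (by
      rintro _ ⟨χ, hχ, rfl⟩ _ ⟨χ', hχ', rfl⟩
      refine ⟨_, ⟨χ ⊓ χ', Formula.realize_inf.2 ⟨hχ, hχ'⟩, rfl⟩, fun y hy => ?_⟩
      rw [realize_βTo2] at hy ⊢
      rw [realize_βTo2]
      exact Formula.realize_inf.1 hy) (by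
      rintro _ ⟨χ, hχ, rfl⟩
      obtain ⟨y, hy⟩ := h'.beta.exists_realize hχ
      exact ⟨y, realize_βTo2.2 hy⟩)
  have hβ' : SameType S.Lβ (Sum.elim c' fun _ : Unit => b) (Sum.elim d' fun _ : Unit => y ()) :=
    sameType_of_imp fun χ hχ => realize_βTo2.1 (hy _ ⟨χ, hχ, rfl⟩)
  -- Otherwise `y ()` is a component of `d'`, so `b` equals the corresponding component of `c'` and
  -- lies in `A`.
  have hyA : y () ∉ S.setA N := by
    intro hyA
    have h1 : (fewer m φ).Realize (Sum.elim (d' ∘ e) fun _ => y ()) := by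
      have h1 := hβ' ((fewer m φ).relabel (Sum.map e id))
      rw [Formula.realize_relabel, Formula.realize_relabel, Sum.elim_comp_map,
        Sum.elim_comp_map] at h1
      exact h1.1 hφ
    obtain ⟨i, hi⟩ := hE _ hyA h1
    have h2 : c' i = b := (hβ'.eq_iff (i := Sum.inl i) (j := Sum.inr ())).2 hi
    exact hbA (h2 ▸ (h'.mem i).2 (hi ▸ hyA))
  refine ⟨ι' ⊕ Unit, inferInstance, Sum.inl ∘ e, _, _,
    h'.extend (model_T2_closureAxioms hM2) (model_T2_closureAxioms hN2) hβ'
      (iff_of_false hbA hyA) (fun h1 => absurd h1 hbA) ?_ ?_, rfl, rfl, ⟨Sum.inr (), rfl⟩⟩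
  · exact h'.free_left.insert_of_mem (isPregeometry_acl hβ hM2) (Or.inr hb')
  · exact h'.free_right.insert_of_mem (isPregeometry_acl hβ hN2) (Or.inr (hβ'.mem_acl hb'))

theorem exists_extend (hβ : IsGeometric Tβ) (hT : IsMLTheory Tα Tβ T)
    (hκ : max ℵ₀ S.L2.card < κ) (hM : IsPartialSaturated S.L2 κ M)
    (hN : IsPartialSaturated S.L2 κ N) (h : S.IsPartialIso c d) (b : M) :
    ∃ (ι' : Type) (_ : Finite ι') (e : ι → ι') (c' : ι' → M) (d' : ι' → N),
      S.IsPartialIso c' d' ∧ c' ∘ e = c ∧ d' ∘ e = d ∧ b ∈ Set.range c' := by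
  by_cases hb : b ∈ acl S.Lβ (S.setA M ∪ Set.range c)
  · have hcl := isPregeometry_acl hβ (M.is_model.mono hT.extends_T2 : M ⊨ S.T2 Tα Tβ)
    obtain ⟨Y, hY, hYfin, hbY⟩ := hcl.finitary _ _ hb
    -- By finite character, finitely many elements of `A` make `b` algebraic over the extended
    -- tuple.
    obtain ⟨ι', _, e, c', d', h', rfl, rfl, hF⟩ := h.exists_extend_finite hβ hT hκ hN
      (hYfin.inter_of_left (S.setA M)) Set.inter_subset_right
    obtain ⟨ι'', h1, e', c'', d'', h2, rfl, rfl, h5⟩ :=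
      h'.exists_extend_of_mem_acl hβ hT hκ hM hN (b := b) (hcl.mono _ _ (fun y hy => by
        rcases hY hy with h1 | h1
        · exact hF ⟨hy, h1⟩
        · exact Set.range_comp_subset_range e c' h1) hbY)
    exact ⟨ι'', h1, e' ∘ e, c'', d'', h2, rfl, rfl, h5⟩
  · obtain ⟨a, ha⟩ := h.exists_extend_of_notMem_acl hβ hT hκ hN hb
    exact ⟨ι ⊕ Unit, inferInstance, Sum.inl, _, _, ha, rfl, rfl, Sum.inr (), rfl⟩

end MLTheory

end IsPartialIso

end PairLanguage

end MLPairs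

namespace MLPairs

namespace PairLanguage

variable {S : PairLanguage.{u, v}} {Tα : S.Lα.Theory} {Tβ : S.Lβ.Theory} {T : S.L2.Theory}

/-! ### Elementarity by back-and-forth -/

section Elementary

variable {M N : Theory.ModelType.{u, v, max u v} T} {κ : Cardinal.{max u v}}

theorem IsPartialIso.exists_extend_set {ι : Type} [Finite ι] {c : ι → M} {d : ι → N}
    (hβ : IsGeometric Tβ) (hT : IsMLTheory Tα Tβ T)
    (hκ : max ℵ₀ S.L2.card < κ) (hM : IsPartialSaturated S.L2 κ M)
    (hN : IsPartialSaturated S.L2 κ N) (h : S.IsPartialIso c d) {F : Set M} (hF : F.Finite) :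
    ∃ (ι' : Type) (_ : Finite ι') (e : ι → ι') (c' : ι' → M) (d' : ι' → N),
      S.IsPartialIso c' d' ∧ c' ∘ e = c ∧ d' ∘ e = d ∧ F ⊆ Set.range c' := by
  induction F, hF using Set.Finite.induction_on with
  | empty => exact ⟨ι, inferInstance, id, c, d, h, rfl, rfl, Set.empty_subset _⟩
  | @insert b F _ _ ih =>
    obtain ⟨ι', _, e, c', d', h', rfl, rfl, hF'⟩ := ih
    obtain ⟨ι'', h1, e', c'', d'', h2, rfl, rfl, h5⟩ := h'.exists_extend hβ hT hκ hM hN b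
    exact ⟨ι'', h1, e' ∘ e, c'', d'', h2, rfl, rfl,
      Set.insert_subset h5 (hF'.trans (Set.range_comp_subset_range _ _))⟩

/-- Relations of `L_α \ L_β` fail on both sides as soon as one component is outside `A`; inside `A`
the `L_α`-types decide. -/
theorem IsPartialIso.relMap_iff {ι : Type} {c : ι → M} {d : ι → N} (hM : M ⊨ S.T2 Tα Tβ)
    (hN : N ⊨ S.T2 Tα Tβ) (h : S.IsPartialIso c d) {n : ℕ} (R : ExtraRel S.alphaOnly n)
    (j : Fin n → ι) :
    Structure.RelMap (L := S.L2) (Sum.inr R) (c ∘ j) ↔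
      Structure.RelMap (L := S.L2) (Sum.inr R) (d ∘ j) := by
  cases R with
  | predA =>
    have h1 : ∀ {K : Type _} (z : Fin 1 → K), z = ![z 0] := fun z => by
      funext i
      rw [Subsingleton.elim i 0]
      rfl
    rw [h1 (c ∘ j), h1 (d ∘ j)]
    exact h.mem (j 0)
  | ofAlpha R =>
    by_cases hx : ∀ i, c (j i) ∈ S.setA M
    · exact h.alpha (Fin n) j hx (Relations.formula (L := S.Lα) (Sum.inr R) Term.var)
    · refine iff_of_false (fun h1 => hx (mem_setA_of_relMap hM h1)) fun h1 => hx fun i => ?_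
      exact (h.mem (j i)).2 (mem_setA_of_relMap hN h1 i)

theorem realize_βTo2_term {K : Type*} [S.L2.Structure K] {γ : Type*} (t : S.Lβ.Term γ)
    (x : γ → K) : (S.βTo2.onTerm t).realize x = t.realize x :=
  LHom.realize_onTerm _ _ _

/-- Partial isomorphisms between saturated models are elementary. -/
theorem IsPartialIso.realize_iff (hβ : IsGeometric Tβ) (hT : IsMLTheory Tα Tβ T)
    (hκ : max ℵ₀ S.L2.card < κ) (hM : IsPartialSaturated S.L2 κ M)
    (hN : IsPartialSaturated S.L2 κ N) {γ : Type} {n : ℕ} (φ : S.L2.BoundedFormula γ n) :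
    ∀ {ι : Type} [Finite ι] {c : ι → M} {d : ι → N}, S.IsPartialIso c d →
      ∀ (v : γ → ι) (xs : Fin n → ι), φ.Realize (c ∘ v) (c ∘ xs) ↔ φ.Realize (d ∘ v) (d ∘ xs) := by
  have hM2 : M ⊨ S.T2 Tα Tβ := M.is_model.mono hT.extends_T2
  have hN2 : N ⊨ S.T2 Tα Tβ := N.is_model.mono hT.extends_T2
  induction φ with
  | falsum => exact fun _ _ _ => Iff.rfl
  | equal t₁ t₂ =>
    intro ι _ c d h v xs
    obtain ⟨t₁, rfl⟩ := exists_term_β t₁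
    obtain ⟨t₂, rfl⟩ := exists_term_β t₂
    have h1 := (h.beta.comp (Sum.elim v xs)) (Term.equal t₁ t₂)
    rw [Formula.realize_equal, Formula.realize_equal] at h1
    simpa only [BoundedFormula.Realize, realize_βTo2_term, Sum.comp_elim] using h1
  | @rel n l R ts =>
    intro ι _ c d h v xs
    choose ts' hts' using fun i => exists_term_β (ts i)
    obtain rfl : (fun i => S.βTo2.onTerm (ts' i)) = ts := funext hts'
    simp only [BoundedFormula.Realize, realize_βTo2_term, ← Sum.comp_elim]
    rcases R with R | R
    · have h1 := (h.beta.comp (Sum.elim v xs)) (Relations.formula (L := S.Lβ) R ts')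
      rw [Formula.realize_rel, Formula.realize_rel] at h1
      exact h1
    -- The values of `L_β`-terms need not be components of the tuple, so they are added before the
    -- extra relations are compared; their images are determined by the `L_β`-type.
    · obtain ⟨ι', _, e, c', d', h', rfl, rfl, hF⟩ := h.exists_extend_set hβ hT hκ hM hN
        (Set.finite_range fun i => (ts' i).realize (c ∘ Sum.elim v xs))
      choose j hj using fun i => hF ⟨i, rfl⟩
      have h1 : ∀ i, d' (j i) = (ts' i).realize ((d' ∘ e) ∘ Sum.elim v xs) := by
        intro i
        have h2 := h'.beta (Term.equal (Term.var (j i)) ((ts' i).relabel (e ∘ Sum.elim v xs)))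
        simp only [Formula.realize_equal, Term.realize_var, Term.realize_relabel] at h2
        exact h2.1 (hj i)
      have h2 := h'.relMap_iff hM2 hN2 R j
      rw [show c' ∘ j = _ from funext hj, show d' ∘ j = _ from funext h1] at h2
      exact h2
  | imp φ ψ ih₁ ih₂ =>
    intro ι _ c d h v xs
    rw [BoundedFormula.realize_imp, BoundedFormula.realize_imp, ih₁ h, ih₂ h]
  | all φ ih =>
    intro ι _ c d h v xs
    rw [BoundedFormula.realize_all, BoundedFormula.realize_all]
    have hsnoc : ∀ {ι' : Type} {K : Type (max u v)} (e : ι → ι') (z : ι' → K) (i : ι'),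
        (Fin.snoc ((z ∘ e) ∘ xs) (z i) : Fin _ → K) = z ∘ (Fin.snoc (e ∘ xs) i : Fin _ → ι') :=
      fun e z i => by rw [Fin.comp_snoc, Function.comp_assoc]
    constructor
    · intro h1 b
      obtain ⟨ι', _, e, d', c', h', rfl, rfl, i, rfl⟩ := h.symm.exists_extend hβ hT hκ hN hM b
      have h2 := h1 (c' i)
      rw [hsnoc, Function.comp_assoc, ih h'.symm] at h2
      rwa [hsnoc, Function.comp_assoc]
    · intro h1 b
      obtain ⟨ι', _, e, c', d', h', rfl, rfl, i, rfl⟩ := h.exists_extend hβ hT hκ hM hN b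
      have h2 := h1 (d' i)
      rw [hsnoc, Function.comp_assoc, ← ih h'] at h2
      rwa [hsnoc, Function.comp_assoc]

end Elementary

/-! ### From special formulas to partial isomorphisms -/

section Special

/-- The special formula `∃ x (A(x) ∧ ψ_A(x) ∧ φ(x, y))`. -/
noncomputable def special {γ : Type w} {k : ℕ} (ψ : S.Lα.Formula (Fin k))
    (φ : S.Lβ.Formula (γ ⊕ Fin k)) : S.L2.Formula γ :=
  Formula.iExs (Fin k)
    (allInA S.predA Sum.inr ⊓ (S.relativize ψ).relabel Sum.inr ⊓ S.βTo2.onFormula φ)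

theorem isSpecial_special {γ : Type w} {k : ℕ} (ψ : S.Lα.Formula (Fin k))
    (φ : S.Lβ.Formula (γ ⊕ Fin k)) : IsSpecial (special ψ φ) :=
  ⟨k, ψ, φ, rfl⟩

theorem realize_special {M : Type*} [S.L2.Structure M] {γ : Type w} {k : ℕ}
    {ψ : S.Lα.Formula (Fin k)} {φ : S.Lβ.Formula (γ ⊕ Fin k)} {x : γ → M} :
    (special ψ φ).Realize x ↔ ∃ a : Fin k → M, (∀ i, a i ∈ S.setA M) ∧
      (S.relativize ψ).Realize a ∧ φ.Realize (Sum.elim x a) := by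
  simp only [special, Formula.realize_iExs, Formula.realize_inf, realize_allInA, realize_βTo2,
    Formula.realize_relabel, Sum.elim_comp_inr, Sum.elim_inr, and_assoc]

variable {M N : Theory.ModelType.{u, v, max u v} T} {κ : Cardinal.{max u v}}

/-- If a tuple satisfies all special formulas that are true for another one then independence over
`A` transfers. -/
theorem clIndependent_of_special (hT : IsMLTheory Tα Tβ T) (hβ : IsGeometric Tβ)
    {n : ℕ} {x : Fin n → M} {y : Fin n → N}
    (h : ∀ θ : S.L2.Formula (Fin n), IsSpecial θ → θ.Realize y → θ.Realize x) {B : Set M}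
    (hB : ClIndependent (acl S.Lβ) B (S.setA M)) (s : B → Fin n) (hs : ∀ b, x (s b) = b) :
    ClIndependent (acl S.Lβ) (y '' Set.range s) (S.setA N) := by
  classical
  have hclM := isPregeometry_acl hβ (M.is_model.mono hT.extends_T2 : M ⊨ S.T2 Tα Tβ)
  have hclN := isPregeometry_acl hβ (N.is_model.mono hT.extends_T2 : N ⊨ S.T2 Tα Tβ)
  rintro _ ⟨_, ⟨b, rfl⟩, rfl⟩ hcl
  obtain ⟨F, hF, hFfin, hbF⟩ := hclN.finitary _ _ hcl
  obtain ⟨k, t, -, ht⟩ := (hFfin.inter_of_left (S.setA N)).fin_param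
  let J := {b' : B // b' ≠ b}
  have h1 : y (s b) ∈ acl S.Lβ (Set.range (Sum.elim (fun j : J => y (s j.1)) t)) := by
    refine hclN.mono _ _ (fun a ha => ?_) hbF
    rcases hF ha with h2 | ⟨⟨_, ⟨b', rfl⟩, rfl⟩, h3⟩
    · obtain ⟨i, hi⟩ := ht.ge ⟨ha, h2⟩
      exact ⟨Sum.inr i, hi⟩
    · exact ⟨Sum.inl ⟨b', fun h4 => h3 (h4 ▸ rfl)⟩, rfl⟩
  obtain ⟨m, φ, hφ⟩ := mem_acl_range_iff.1 h1
  let g : (J ⊕ Fin k) ⊕ Unit → Fin n ⊕ Fin k :=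
    Sum.elim (Sum.elim (fun j => Sum.inl (s j.1)) Sum.inr) fun _ => Sum.inl (s b)
  have hg : ∀ {K : Type (max u v)} (z : Fin n → K) (t : Fin k → K), Sum.elim z t ∘ g =
      Sum.elim (Sum.elim (fun j : J => z (s j.1)) t) fun _ => z (s b) := fun z t => by
    funext i
    rcases i with (i | i) | i <;> rfl
  -- A dependence of `y (s b)` on the other elements and on `t` from `A` becomes a special formula
  -- once `t` is quantified. It transfers to `x` and contradicts the independence of `B`.
  have h2 := h _ (isSpecial_special ⊤ ((fewer m φ).relabel g)) (realize_special.2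
    ⟨t, fun i => (ht.le ⟨i, rfl⟩).2, id, by rwa [Formula.realize_relabel, hg]⟩)
  obtain ⟨t', ht', -, hφ'⟩ := realize_special.1 h2
  rw [Formula.realize_relabel, hg, hs] at hφ'
  refine hB b b.2 (hclM.mono _ _ ?_ (mem_acl_range_iff.2 ⟨m, φ, hφ'⟩))
  rintro _ ⟨i | i, rfl⟩
  · refine Or.inr ⟨?_, fun h3 => i.2 (Subtype.ext ?_)⟩
    · simp only [Sum.elim_inl, hs]
      exact i.1.2
    · simpa only [Sum.elim_inl, hs, Set.mem_singleton_iff] using h3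
  · exact Or.inl (ht' i)

/-- Tuples that satisfy the same special formulas correspond to each other under a partial
isomorphism, if the second one lies in a saturated model. -/
theorem exists_isPartialIso (hβ : IsGeometric Tβ) (hT : IsMLTheory Tα Tβ T)
    (hκ : ℵ₀ ≤ κ) (hN : IsPartialSaturated S.L2 κ N) {n : ℕ} {x : Fin n → M} {y : Fin n → N}
    (h : ∀ θ : S.L2.Formula (Fin n), IsSpecial θ → (θ.Realize x ↔ θ.Realize y)) :
    ∃ (ι : Type) (_ : Finite ι) (e : Fin n → ι) (c : ι → M) (d : ι → N),
      S.IsPartialIso c d ∧ c ∘ e = x ∧ d ∘ e = y := by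
  have hM2 : M ⊨ S.T2 Tα Tβ := M.is_model.mono hT.extends_T2
  have hN2 : N ⊨ S.T2 Tα Tβ := N.is_model.mono hT.extends_T2
  have hclM := isPregeometry_acl hβ hM2
  have hclN := isPregeometry_acl hβ hN2
  obtain ⟨B, hBx, hB, hxB⟩ := hclM.exists_basis (Set.range x) (S.setA M)
  choose s hs using fun b : B => hBx b.2
  choose Y hY hYfin hxY using fun i => hclM.finitary _ _ (hxB ⟨i, rfl⟩)
  -- The tuple `a` lists the elements of `A` needed to generate `x` over `B`, together with the
  -- components of `x` in `A`; so `(x, a)` is free.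
  obtain ⟨k, a, -, ha⟩ := (((Set.finite_iUnion hYfin).union (Set.finite_range x)).inter_of_left
    (S.setA M)).fin_param
  have haA : ∀ i, a i ∈ S.setA M := fun i => (ha.le ⟨i, rfl⟩).2
  have hxa : ∀ i, x i ∈ S.setA M → ∃ j, a j = x i := fun i hi => ha.ge ⟨Or.inr ⟨i, rfl⟩, hi⟩
  have hxcl : ∀ i, x i ∈ acl S.Lβ (Set.range (Sum.elim (fun b : B => x (s b)) a)) := by
    refine fun i => hclM.mono _ _ (fun z hz => ?_) (hxY i)
    rcases hY i hz with h1 | h1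
    · obtain ⟨j, hj⟩ := ha.ge ⟨Or.inl (Set.mem_iUnion.2 ⟨i, hz⟩), h1⟩
      exact ⟨Sum.inr j, hj⟩
    · exact ⟨Sum.inl ⟨z, h1⟩, hs ⟨z, h1⟩⟩
  let F : S.Lβ.Formula (Fin n ⊕ Fin k) → S.Lα.Formula (Fin k) → S.L2.Formula (Fin n ⊕ Fin k) :=
    fun φ ψ => allInA S.predA Sum.inr ⊓ (S.relativize ψ).relabel Sum.inr ⊓ S.βTo2.onFormula φ
  have hF : ∀ φ ψ (z : Fin k → N), (F φ ψ).Realize (Sum.elim y z) ↔ (∀ i, z i ∈ S.setA N) ∧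
      (S.relativize ψ).Realize z ∧ φ.Realize (Sum.elim y z) := by
    intro φ ψ z
    simp only [F, Formula.realize_inf, realize_allInA, realize_βTo2, Formula.realize_relabel,
      Sum.elim_comp_inr, Sum.elim_inr, and_assoc]
  -- Each finite part of the joint description of `a` over `x` amounts to a special formula true of
  -- `x`, hence of `y`.
  obtain ⟨a', ha'⟩ := hN.exists_realize hκ y
    {γ | ∃ φ ψ, φ.Realize (Sum.elim x a) ∧ (S.relativize ψ).Realize a ∧ γ = F φ ψ}
    ⟨F ⊤ ⊤, ⊤, ⊤, Formula.realize_top.2 trivial, id, rfl⟩ (by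
      rintro _ ⟨φ, ψ, hφ, hψ, rfl⟩ _ ⟨φ', ψ', hφ', hψ', rfl⟩
      refine ⟨_, ⟨φ ⊓ φ', ψ ⊓ ψ', Formula.realize_inf.2 ⟨hφ, hφ'⟩, ?_, rfl⟩, fun y => ?_⟩
      · rw [relativize_inf]
        exact Formula.realize_inf.2 ⟨hψ, hψ'⟩
      · rw [hF, hF, hF, relativize_inf, Formula.realize_inf, Formula.realize_inf]
        tauto) (by
      rintro _ ⟨φ, ψ, hφ, hψ, rfl⟩
      obtain ⟨z, hz⟩ := realize_special.1 ((h _ (isSpecial_special ψ φ)).1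
        (realize_special.2 ⟨a, haA, hψ, hφ⟩))
      exact ⟨z, (hF _ _ _).2 hz⟩)
  have ha'A : ∀ i, a' i ∈ S.setA N :=
    ((hF _ _ _).1 (ha' _ ⟨⊤, ⊤, Formula.realize_top.2 trivial, id, rfl⟩)).1
  have hβ' : SameType S.Lβ (Sum.elim x a) (Sum.elim y a') := sameType_of_imp fun φ hφ =>
    ((hF _ _ _).1 (ha' _ ⟨φ, ⊤, hφ, id, rfl⟩)).2.2
  have hα' : ∀ ψ, (S.relativize ψ).Realize a → (S.relativize ψ).Realize a' := fun ψ hψ =>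
    ((hF _ _ _).1 (ha' _ ⟨⊤, ψ, Formula.realize_top.2 trivial, hψ, rfl⟩)).2.1
  have hsel : ∀ i, Sum.elim x a i ∈ S.setA M → ∃ j, a j = Sum.elim x a i := by
    rintro (i | i) hi
    · exact hxa i hi
    · exact ⟨i, rfl⟩
  have htr : ∀ i j, a j = Sum.elim x a i → a' j = Sum.elim y a' i := fun i j hij =>
    (hβ'.eq_iff (i := Sum.inr j) (j := i)).1 hij
  refine ⟨Fin n ⊕ Fin k, inferInstance, Sum.inl, Sum.elim x a, Sum.elim y a',
    ⟨hβ', fun i => ⟨fun hi => ?_, fun hi => ?_⟩, fun η e he ψ => ?_, ?_, ?_⟩, rfl, rfl⟩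
  · obtain ⟨j, hj⟩ := hsel i hi
    rw [← htr i j hj]
    exact ha'A j
  · rcases i with i | i
    -- Membership in `A` is itself special: some element of `A` equals the given component.
    · have h1 := (h _ (isSpecial_special (k := 1) ⊤
        (Term.equal (Term.var (Sum.inl i)) (Term.var (Sum.inr 0))))).2 (realize_special.2
          ⟨fun _ => y i, fun _ => hi, id, by simp [Formula.realize_equal]⟩)
      obtain ⟨z, hz, -, h2⟩ := realize_special.1 h1
      rw [Formula.realize_equal] at h2
      simp only [Term.realize_var, Sum.elim_inl, Sum.elim_inr] at h2
      rw [Sum.elim_inl, h2]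
      exact hz 0
    · exact haA i
  · choose g hg using fun j => hsel _ (he j)
    have h1 : Sum.elim x a ∘ e = a ∘ g := funext fun j => (hg j).symm
    have h2 : Sum.elim y a' ∘ e = a' ∘ g := funext fun j => (htr _ _ (hg j)).symm
    rw [h1, h2, ← realize_relativize_relabel (model_T2_closureAxioms hM2) _ _ haA,
      ← realize_relativize_relabel (model_T2_closureAxioms hN2) _ _ ha'A]
    refine ⟨hα' _, fun h3 => ?_⟩
    by_contra h4
    exact hα' (ψ.relabel g).not h4 h3
  · refine ⟨B, fun b hb => ⟨Sum.inl (s ⟨b, hb⟩), hs _⟩, ?_, hB⟩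
    rintro _ ⟨i | i, rfl⟩
    · refine hclM.mono _ _ ?_ (hxcl i)
      rintro _ ⟨b | j, rfl⟩
      · refine Or.inl ?_
        rw [Sum.elim_inl, hs]
        exact b.2
      · exact Or.inr ⟨⟨Sum.inr j, rfl⟩, haA j⟩
    · exact hclM.subset_cl _ (Or.inr ⟨⟨Sum.inr i, rfl⟩, haA i⟩)
  · refine ⟨y '' Set.range s, ?_, ?_, clIndependent_of_special hT hβ
      (fun θ hθ => (h θ hθ).2) hB s hs⟩
    · rintro _ ⟨i, -, rfl⟩
      exact ⟨Sum.inl i, rfl⟩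
    rintro _ ⟨i | i, rfl⟩
    · have h1 := hβ'.comp (Sum.elim (Sum.elim (fun b : B => Sum.inl (s b)) Sum.inr)
        fun _ : Unit => Sum.inl i)
      have h2 : y i ∈ acl S.Lβ (Set.range (Sum.elim (fun b : B => y (s b)) a')) := by
        refine SameType.mem_acl (c := Sum.elim (fun b : B => x (s b)) a) (b := x i) ?_ (hxcl i)
        convert h1 using 1 <;>
        · funext z
          rcases z with (z | z) | z <;> rfl
      refine hclN.mono _ _ ?_ h2
      rintro _ ⟨b | j, rfl⟩
      · exact Or.inl ⟨_, ⟨b, rfl⟩, rfl⟩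
      · exact Or.inr ⟨⟨Sum.inr j, rfl⟩, ha'A j⟩
    · exact hclN.subset_cl _ (Or.inr ⟨⟨Sum.inr i, rfl⟩, ha'A i⟩)

/-- In a Mordell-Lang theory, each formula is equivalent to a boolean combination of special
formulas. -/
theorem IsMLTheory.exists_isBoolComb_isSpecial (hβ : IsGeometric Tβ) (hT : IsMLTheory Tα Tβ T)
    (n : ℕ) (φ : S.L2.Formula (Fin n)) :
    ∃ χ : S.L2.Formula (Fin n), IsBoolComb IsSpecial χ ∧ φ ⇔[T] χ := by
  refine exists_isBoolComb_iff T IsSpecial φ fun M₀ N₀ x₀ y₀ h₀ hφ => ?_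
  let P := (max ℵ₀ S.L2.card).out
  have hP : #P = max ℵ₀ S.L2.card := Cardinal.mk_out _
  have : Infinite P := Cardinal.infinite_iff.2 (by rw [hP]; exact le_max_left _ _)
  have hκ : max ℵ₀ S.L2.card < Order.succ #P := by
    rw [hP]
    exact Order.lt_succ _
  -- Full `L²`-types are preserved, so the comparison may be made in saturated models.
  obtain ⟨M, x, hx, hM⟩ := exists_saturated P {θ | θ.Realize x₀} M₀ x₀ fun _ h => h
  obtain ⟨N, y, hy, hN⟩ := exists_saturated P {θ | θ.Realize y₀} N₀ y₀ fun _ h => h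
  have hx' : SameType S.L2 x₀ x := sameType_of_imp hx
  have hy' : SameType S.L2 y₀ y := sameType_of_imp hy
  obtain ⟨ι, _, e, c, d, h, rfl, rfl⟩ := exists_isPartialIso hβ hT
    ((le_max_left _ _).trans hκ.le) hN fun θ hθ => by rw [← hx', ← hy', h₀ θ hθ]
  rw [hx'] at hφ
  rw [hy']
  have h1 := h.realize_iff hβ hT hκ hM hN φ e Fin.elim0
  rw [Subsingleton.elim (c ∘ Fin.elim0) default, Subsingleton.elim (d ∘ Fin.elim0) default] at h1
  exact h1.1 hφ

end Special

end PairLanguage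

end MLPairs

namespace MLPairs

/-! ### Parameters as variables -/

section FreeVariables

variable {L : FirstOrder.Language.{u, v}}

theorem realize_congr_freeVarFinset {γ : Type*} [DecidableEq γ] {φ : L.Formula γ} {M : Type*}
    [L.Structure M] {x y : γ → M} (h : ∀ i ∈ φ.freeVarFinset, x i = y i) :
    φ.Realize x ↔ φ.Realize y := by
  rw [Formula.Realize, Formula.Realize,
    ← BoundedFormula.realize_restrictFreeVar (f := id) (v := fun i => x i) x (fun _ => rfl),
    ← BoundedFormula.realize_restrictFreeVar (f := id) (v := fun i => x i) y fun i => h i i.2]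

theorem exists_formula_fin {γ : Type*} (φ : L.Formula γ) :
    ∃ (k : ℕ) (f : Fin k → γ) (ψ : L.Formula (Fin k)), ∀ (M : Type w') [L.Structure M] (x : γ → M),
      ψ.Realize (x ∘ f) ↔ φ.Realize x := by
  classical
  let e := φ.freeVarFinset.equivFin
  refine ⟨_, fun i => (e.symm i : γ), φ.restrictFreeVar e, fun M _ x => ?_⟩
  exact BoundedFormula.realize_restrictFreeVar x fun i => by simp

end FreeVariables

namespace PairLanguage

variable {S : PairLanguage.{u, v}} {Tα : S.Lα.Theory} {Tβ : S.Lβ.Theory} {T : S.L2.Theory}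

section Parameters

/-- Substitution of parameters for some variables turns boolean combinations of special formulas
into boolean combinations of special formulas with parameters. -/
theorem IsBoolComb.exists_isSpecialOver {C : Type w} {n k : ℕ} (f : Fin k → C ⊕ Fin n)
    {χ : S.L2.Formula (Fin k)} (hχ : IsBoolComb IsSpecial χ) :
    ∃ χ' : S.L2[[C]].Formula (Fin n), IsBoolComb IsSpecialOver χ' ∧
      ∀ (K : Type w') [S.L2[[C]].Structure K] (y : Fin n → K),
        let := (S.L2.lhomWithConstants C).reduct K
        χ'.Realize y ↔ χ.Realize (Sum.elim (fun a => (S.L2.con a : K)) y ∘ f) := by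
  induction hχ with
  | @basic θ hθ =>
    obtain ⟨l, ψ, φ, rfl⟩ := hθ
    -- Parameters enter only `φ`, since `ψ` concerns the quantified tuple alone.
    let g : Fin k ⊕ Fin l → C ⊕ (Fin n ⊕ Fin l) :=
      Sum.elim (fun i => Sum.map id Sum.inl (f i)) fun j => Sum.inr (Sum.inr j)
    refine ⟨_, .basic ⟨l, ψ, BoundedFormula.constantsVarsEquiv.symm (φ.relabel g), rfl⟩, ?_⟩
    intro K _ y
    dsimp only
    let := (S.L2.lhomWithConstants C).reduct K
    let := (S.βTo2.addConstants C).reduct K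
    have : (S.Lβ.lhomWithConstants C).IsExpansionOn K := ⟨fun _ _ => rfl, fun _ _ => rfl⟩
    have hg : ∀ a : Fin l → K, Sum.elim (fun i => (S.Lβ.con i : K)) (Sum.elim y a) ∘ g =
        Sum.elim (Sum.elim (fun i => (S.L2.con i : K)) y ∘ f) a := by
      intro a
      funext i
      rcases i with i | i
      · simp only [g, Function.comp_apply, Sum.elim_inl]
        rcases f i with j | j <;> rfl
      · rfl
    refine Iff.trans ?_ realize_special.symm
    rw [Formula.realize_iExs]
    refine exists_congr fun a => ?_
    rw [Formula.realize_inf, Formula.realize_inf, and_assoc, Formula.realize_relabel,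
      Sum.elim_comp_inr, LHom.realize_onFormula, LHom.realize_onFormula]
    refine and_congr ?_ (and_congr Iff.rfl ?_)
    · simp only [allInA, Formula.realize_iInf, Formula.realize_rel₁, Term.realize_var, Sum.elim_inr]
      rfl
    · rw [← hg, ← Formula.realize_relabel, Formula.Realize, Formula.Realize,
        ← BoundedFormula.realize_constantsVarsEquiv, Equiv.apply_symm_apply]
  | bot => exact ⟨⊥, .bot, fun K _ y => Iff.rfl⟩
  | not _ ih =>
    obtain ⟨χ', h1, h2⟩ := ih
    exact ⟨_, h1.not, fun K _ y => not_congr (h2 K y)⟩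
  | inf _ _ ih₁ ih₂ =>
    obtain ⟨χ₁, h1, h2⟩ := ih₁
    obtain ⟨χ₂, h3, h4⟩ := ih₂
    refine ⟨_, h1.inf h3, fun K _ y => ?_⟩
    let := (S.L2.lhomWithConstants C).reduct K
    exact Formula.realize_inf.trans ((and_congr (h2 K y) (h4 K y)).trans Formula.realize_inf.symm)
  | sup _ _ ih₁ ih₂ =>
    obtain ⟨χ₁, h1, h2⟩ := ih₁
    obtain ⟨χ₂, h3, h4⟩ := ih₂
    refine ⟨_, h1.sup h3, fun K _ y => ?_⟩
    let := (S.L2.lhomWithConstants C).reduct K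
    exact Formula.realize_sup.trans ((or_congr (h2 K y) (h4 K y)).trans Formula.realize_sup.symm)

theorem IsMLTheory.exists_isBoolComb_isSpecialOver (hβ : IsGeometric Tβ)
    (hT : IsMLTheory Tα Tβ T) {C : Type w} (n : ℕ) (φ : S.L2[[C]].Formula (Fin n)) :
    ∃ χ : S.L2[[C]].Formula (Fin n), IsBoolComb IsSpecialOver χ ∧
      φ ⇔[(S.L2.lhomWithConstants C).onTheory T] χ := by
  -- Only finitely many parameters occur in `φ`, so with constants as variables it is a formula in
  -- finitely many variables.
  obtain ⟨k, f, ψ, hψ⟩ := exists_formula_fin.{u, v, max u v w} (BoundedFormula.constantsVarsEquiv φ)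
  obtain ⟨χ', hχ', hψχ⟩ := hT.exists_isBoolComb_isSpecial hβ k ψ
  obtain ⟨χ, hχ, h⟩ := IsBoolComb.exists_isSpecialOver.{u, v, w, max u v w} f hχ'
  refine ⟨χ, hχ, fun K y xs => ?_⟩
  rw [Unique.eq_default xs, BoundedFormula.realize_iff]
  let := (S.L2.lhomWithConstants C).reduct K
  have : K ⊨ T := (LHom.onTheory_model _ _).1 K.is_model
  have h1 := Theory.ModelsBoundedFormula.realize_formula hψχ K
    (v := Sum.elim (fun a => (S.L2.con a : K)) y ∘ f)
  rw [Formula.realize_iff, hψ] at h1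
  refine Iff.trans ?_ (h1.trans (h K y).symm)
  exact BoundedFormula.realize_constantsVarsEquiv.symm

end Parameters

end PairLanguage

end MLPairs

namespace MLPairs

/-! ### Embeddings, existential formulas and near model completeness -/

section Existential

variable {L : FirstOrder.Language.{u, v}}

theorem isQF_iInf {γ : Type*} {β : Type*} [Finite β] {f : β → L.Formula γ}
    (h : ∀ b, BoundedFormula.IsQF (f b)) : BoundedFormula.IsQF (Formula.iInf f) := by
  rw [Formula.iInf, BoundedFormula.iInf]
  generalize Finset.toList _ = l
  induction l with
  | nil => exact BoundedFormula.IsQF.top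
  | cons b l ih => exact (h b).inf ih

theorem isExistential_exs {γ : Type*} {n : ℕ} {φ : L.BoundedFormula γ n}
    (h : φ.IsExistential) : BoundedFormula.IsExistential φ.exs := by
  induction n with
  | zero => exact h
  | succ n ih => exact ih h.ex

theorem isExistential_iExs {γ β : Type*} [Finite β] {φ : L.Formula (γ ⊕ β)}
    (h : BoundedFormula.IsQF φ) : BoundedFormula.IsExistential (Formula.iExs β φ) :=
  isExistential_exs (h.relabel _).isExistential

/-- If all existential formulas that hold of `x` in `M` hold of `y` in `N` then `M` embeds into an
elementary extension of `N` by a map that sends `x` to `y`. -/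
theorem exists_amalgam {T : L.Theory} {M N : Theory.ModelType.{u, v, max u v} T} {n : ℕ}
    {x : Fin n → M} {y : Fin n → N}
    (h : ∀ θ : L.Formula (Fin n), BoundedFormula.IsExistential θ → θ.Realize x → θ.Realize y) :
    ∃ (K : Theory.ModelType.{u, v, max u v} T) (f : M ↪[L] K) (g : N → K),
      (∀ (k : ℕ) (φ : L.Formula (Fin k)) (z : Fin k → N), φ.Realize z → φ.Realize (g ∘ z)) ∧
        f ∘ x = g ∘ y := by
  classical
  -- `D` is the quantifier-free diagram of `M` and `E` the elementary diagram of `N`; the added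
  -- equations identify `x` with `y`.
  let D : Set (L.Formula M) := {δ | BoundedFormula.IsQF δ ∧ δ.Realize (id : M → M)}
  let E : Set (L.Formula N) := {δ | δ.Realize (id : N → N)}
  obtain ⟨K, z, hz⟩ := exists_realize_of_finite T (γ := M ⊕ N)
    ((fun δ => δ.relabel Sum.inl) '' D ∪ (fun δ => δ.relabel Sum.inr) '' E ∪
      Set.range fun i => Term.equal (Term.var (Sum.inl (x i))) (Term.var (Sum.inr (y i)))) <| by
    intro s hs hfin
    obtain ⟨D₀, hD₀, hD₀fin, hD₀s⟩ := Set.exists_subset_image_finite_and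
      (f := fun δ : L.Formula M => (δ.relabel Sum.inl : L.Formula (M ⊕ N))) (s := D)
      (p := fun t => s ∩ (fun δ => δ.relabel Sum.inl) '' D ⊆ t).1
      ⟨_, Set.inter_subset_right, hfin.inter_of_left _, subset_rfl⟩
    have : Finite D₀ := hD₀fin
    -- The arbitrary element keeps `V` nonempty and serves as the default value of `r` outside `V`.
    let V : Finset M := insert (Classical.arbitrary M)
      (Finset.univ.image x ∪ hD₀fin.toFinset.biUnion fun δ => δ.freeVarFinset)
    let e := V.equivFin
    let r : M → Fin V.card := fun a => if ha : a ∈ V then e ⟨a, ha⟩ else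
      e ⟨Classical.arbitrary M, Finset.mem_insert_self _ _⟩
    have hr : ∀ a ∈ V, (e.symm (r a) : M) = a := fun a ha => by simp [r, ha]
    -- Quantifying the elements of `V` turns the finite part of the diagram and the equations into
    -- an existential formula true of `x`; witnesses for `y` interpret the names from `M` inside
    -- `N`.
    have hθ := h (Formula.iExs (Fin V.card)
      ((Formula.iInf fun δ : D₀ => δ.1.relabel (Sum.inr ∘ r)) ⊓
        Formula.iInf fun i => Term.equal (Term.var (Sum.inl i)) (Term.var (Sum.inr (r (x i))))))
      (isExistential_iExs ((isQF_iInf fun δ => (hD₀ δ.2).1.relabel _).inf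
        (isQF_iInf fun i => (BoundedFormula.IsAtomic.equal _ _).isQF)))
      (by
        rw [Formula.realize_iExs]
        refine ⟨fun i => (e.symm i : M), ?_⟩
        rw [Formula.realize_inf, Formula.realize_iInf, Formula.realize_iInf]
        refine ⟨fun δ => ?_, fun i => ?_⟩
        · rw [Formula.realize_relabel]
          refine (realize_congr_freeVarFinset fun a ha => ?_).2 (hD₀ δ.2).2
          refine hr a (Finset.mem_insert_of_mem (Finset.mem_union_right _ ?_))
          exact Finset.mem_biUnion.2 ⟨δ.1, hD₀fin.mem_toFinset.2 δ.2, ha⟩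
        · rw [Formula.realize_equal]
          refine (hr (x i) (Finset.mem_insert_of_mem (Finset.mem_union_left _ ?_))).symm
          exact Finset.mem_image_of_mem _ (Finset.mem_univ i))
    rw [Formula.realize_iExs] at hθ
    obtain ⟨t, ht⟩ := hθ
    rw [Formula.realize_inf, Formula.realize_iInf, Formula.realize_iInf] at ht
    refine ⟨N, Sum.elim (t ∘ r) id, fun φ hφ => ?_⟩
    rcases hs hφ with (hD | ⟨δ, hδ, rfl⟩) | ⟨i, rfl⟩
    · obtain ⟨δ, hδ, rfl⟩ := hD₀s ⟨hφ, hD⟩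
      have h1 := ht.1 ⟨δ, hδ⟩
      rw [Formula.realize_relabel] at h1 ⊢
      exact h1
    · rw [Formula.realize_relabel]
      exact hδ
    · have h1 := ht.2 i
      rw [Formula.realize_equal] at h1 ⊢
      exact h1.symm
  have hD : ∀ δ : L.Formula M, BoundedFormula.IsQF δ → (δ.Realize (z ∘ Sum.inl) ↔
      δ.Realize (id : M → M)) := by
    have h1 : ∀ δ : L.Formula M, BoundedFormula.IsQF δ → δ.Realize (id : M → M) →
        δ.Realize (z ∘ Sum.inl) := fun δ hδ hδM => by
      have := hz _ (Or.inl (Or.inl ⟨δ, ⟨hδ, hδM⟩, rfl⟩))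
      rwa [Formula.realize_relabel] at this
    refine fun δ hδ => ⟨fun h2 => ?_, h1 δ hδ⟩
    by_contra h3
    exact h1 δ.not hδ.not h3 h2
  refine ⟨K, ⟨⟨z ∘ Sum.inl, fun a b hab => ?_⟩, fun {l} F a => ?_, fun {l} R a => ?_⟩,
    z ∘ Sum.inr, fun k φ t ht => ?_, funext fun i => ?_⟩
  · exact (hD (Term.equal (Term.var a) (Term.var b)) (BoundedFormula.IsAtomic.equal _ _).isQF).1 hab
  · have h1 := (hD (Term.equal (Term.var (Structure.funMap F a))
      (Term.func F fun i => Term.var (a i))) (BoundedFormula.IsAtomic.equal _ _).isQF).2 (by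
        simp [Formula.realize_equal])
    rw [Formula.realize_equal] at h1
    exact h1
  · have h1 := hD (Relations.formula R fun i => Term.var (a i))
      (BoundedFormula.IsAtomic.rel _ _).isQF
    rw [Formula.realize_rel, Formula.realize_rel] at h1
    exact h1
  · have h1 := hz _ (Or.inl (Or.inr ⟨φ.relabel t, (by
      change (φ.relabel t).Realize id
      rwa [Formula.realize_relabel]), rfl⟩))
    rw [Formula.realize_relabel, Formula.realize_relabel] at h1
    exact h1
  · have h1 := hz _ (Or.inr ⟨i, rfl⟩)
    rw [Formula.realize_equal] at h1
    exact h1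

/-- Boolean combinations do not distinguish tuples that the basic formulas do not distinguish. -/
theorem IsBoolComb.realize_iff {γ : Type w} {P : L.Formula γ → Prop} {χ : L.Formula γ}
    (hχ : IsBoolComb P χ) {M N : Type*} [L.Structure M] [L.Structure N] {x : γ → M} {y : γ → N}
    (h : ∀ θ, P θ → (θ.Realize x ↔ θ.Realize y)) : χ.Realize x ↔ χ.Realize y := by
  induction hχ with
  | basic hθ => exact h _ hθ
  | bot => exact Iff.rfl
  | not _ ih => exact not_congr ih
  | inf _ _ ih₁ ih₂ => rw [Formula.realize_inf, Formula.realize_inf, ih₁, ih₂]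
  | sup _ _ ih₁ ih₂ => rw [Formula.realize_sup, Formula.realize_sup, ih₁, ih₂]

end Existential

namespace PairLanguage

variable {S : PairLanguage.{u, v}} {Tα : S.Lα.Theory} {Tβ : S.Lβ.Theory} {T : S.L2.Theory}

/-- Special formulas are preserved by embeddings if the component theories are model complete. -/
theorem realize_special_of_embedding (hTα : ModelComplete Tα) (hTβ : ModelComplete Tβ)
    {M K : Type (max u v)} [S.L2.Structure M] [S.L2.Structure K] [Nonempty M] [Nonempty K]
    (hM : M ⊨ S.T2 Tα Tβ) (hK : K ⊨ S.T2 Tα Tβ) (f : M ↪[S.L2] K) {n : ℕ}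
    {θ : S.L2.Formula (Fin n)} (hθ : IsSpecial θ) {x : Fin n → M} (hx : θ.Realize x) :
    θ.Realize (f ∘ x) := by
  obtain ⟨k, ψ, φ, rfl⟩ := hθ
  obtain ⟨a, haA, hψ, hφ⟩ := realize_special.1 hx
  have := model_β hM
  have := model_β hK
  have := model_α hM
  have := model_α hK
  have := nonempty_alphaPart hM
  have := nonempty_alphaPart hK
  have hfA : ∀ b, b ∈ S.setA M → f b ∈ S.setA K := fun b hb => by
    have h1 := (f.map_rel S.predA ![b]).2 hb
    have h2 : f ∘ ![b] = ![f b] := by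
      funext i
      rw [Subsingleton.elim i 0]
      rfl
    rwa [h2] at h1
  -- The embedding of pairs induces embeddings of both components, which are elementary by model
  -- completeness and so preserve `φ` and `ψ`.
  let fβ : Theory.ModelType.of Tβ M ↪[S.Lβ] Theory.ModelType.of Tβ K :=
    ⟨f.toEmbedding, fun F b => f.map_fun' (S.βTo2.onFunction F) b,
      fun R b => f.map_rel' (S.βTo2.onRelation R) b⟩
  let fα : Theory.ModelType.of Tα (S.alphaPart M (model_T2_closureAxioms hM)) ↪[S.Lα]
      Theory.ModelType.of Tα (S.alphaPart K (model_T2_closureAxioms hK)) :=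
    ⟨⟨fun b => ⟨f b.1, hfA _ b.2⟩, fun b c hbc => Subtype.ext (f.injective (Subtype.ext_iff.1 hbc))⟩,
      fun F b => Subtype.ext (f.map_fun' (S.αTo2.onFunction F) fun i => (b i).1),
      fun R b => f.map_rel' (S.αTo2.onRelation R) fun i => (b i).1⟩
  refine realize_special.2 ⟨f ∘ a, fun i => hfA _ (haA i), ?_, ?_⟩
  · rw [realize_relativize_mk (model_T2_closureAxioms hM) _ haA] at hψ
    refine (realize_relativize_mk (model_T2_closureAxioms hK) _ fun i => hfA _ (haA i)).2 ?_
    exact (hTα _ _ fα k ψ _).2 hψ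
  · have h1 := hTβ _ _ fβ (n + k) (φ.relabel finSumFinEquiv) (Sum.elim x a ∘ finSumFinEquiv.symm)
    rw [Formula.realize_relabel, Formula.realize_relabel, Function.comp_assoc,
      Function.comp_assoc, Equiv.symm_comp_self, Function.comp_id] at h1
    rw [← Sum.comp_elim]
    exact h1.2 hφ

/-- If `x` and `y` satisfy the same existential formulas, a special formula true of `x` passes up
the embedding into the amalgam and back down to `y` by elementarity. So existential formulas decide
special ones, and by (a) all formulas. -/
theorem IsMLTheory.nearModelComplete (hβ : IsGeometric Tβ) (hT : IsMLTheory Tα Tβ T)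
    (hTα : ModelComplete Tα) (hTβ : ModelComplete Tβ) : NearModelComplete T := by
  intro n φ
  obtain ⟨χ, hχ, hφχ⟩ := hT.exists_isBoolComb_isSpecial hβ n φ
  have key : ∀ (M N : Theory.ModelType.{u, v, max u v} T) (x : Fin n → M) (y : Fin n → N),
      (∀ θ : S.L2.Formula (Fin n), BoundedFormula.IsExistential θ →
        (θ.Realize x ↔ θ.Realize y)) →
      ∀ θ : S.L2.Formula (Fin n), IsSpecial θ → θ.Realize x → θ.Realize y := by
    intro M N x y h θ hθ hx
    obtain ⟨K, f, g, hg, hfg⟩ := exists_amalgam fun θ hθ => (h θ hθ).1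
    have h1 := realize_special_of_embedding hTα hTβ (M.is_model.mono hT.extends_T2)
      (K.is_model.mono hT.extends_T2) f hθ hx
    rw [hfg] at h1
    by_contra h2
    exact hg n θ.not y h2 h1
  refine exists_isBoolComb_iff T _ φ fun M N x y h hφ => ?_
  have h1 : ∀ θ : S.L2.Formula (Fin n), IsSpecial θ → (θ.Realize x ↔ θ.Realize y) := fun θ hθ =>
    ⟨key M N x y h θ hθ, key N M y x (fun θ hθ => (h θ hθ).symm) θ hθ⟩
  have h2 : χ.Realize x ↔ χ.Realize y := hχ.realize_iff h1
  have h3 := Theory.ModelsBoundedFormula.realize_formula hφχ M (v := x)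
  have h4 := Theory.ModelsBoundedFormula.realize_formula hφχ N (v := y)
  rw [Formula.realize_iff] at h3 h4
  exact h4.2 (h2.1 (h3.1 hφ))

end PairLanguage

end MLPairs

theorem mainTheorem6 (S : MLPairs.PairLanguage.{u, v})
    (Tα : S.Lα.Theory) (Tβ : S.Lβ.Theory) (hβ : MLPairs.IsGeometric Tβ)
    (T : S.L2.Theory) (hT : MLPairs.PairLanguage.IsMLTheory Tα Tβ T) :
    -- formulas without parameters
    (∀ (n : ℕ) (φ : S.L2.Formula (Fin n)), ∃ χ : S.L2.Formula (Fin n),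
      MLPairs.IsBoolComb MLPairs.PairLanguage.IsSpecial χ ∧ φ ⇔[T] χ) ∧
    -- formulas with parameters from a model, up to equivalence in `T` as an `L²(C)`-theory
    (∀ (M : Type w) [S.L2.Structure M] [M ⊨ T] [Nonempty M] (C : Set M) (n : ℕ)
      (φ : S.L2[[C]].Formula (Fin n)), ∃ χ : S.L2[[C]].Formula (Fin n),
        MLPairs.IsBoolComb MLPairs.PairLanguage.IsSpecialOver χ ∧
          φ ⇔[(S.L2.lhomWithConstants C).onTheory T] χ) ∧
    -- the consequence for model complete theories
    (MLPairs.ModelComplete Tα → MLPairs.ModelComplete Tβ → MLPairs.NearModelComplete T) := by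
  exact ⟨hT.exists_isBoolComb_isSpecial hβ, fun _ _ _ _ _ n φ =>
    hT.exists_isBoolComb_isSpecialOver hβ n φ, hT.nearModelComplete hβ⟩
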